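/- **Setting.** Let $\mathcal X,\mathcal Y$ be measurable spaces (the $\sigma$-algebra of $\mathcal Y$ countably generated), $\rho$ a probability distribution on prompts $\mathcal X$, and $\pi_{\mathrm{ref}},\pi_{\mathrm{base}}$ two policies, i.e. Markov kernels from $\mathcal X$ to $\mathcal Y$; let $\beta>0$, $B\ge 1$, $C\in\mathbb R$. Write $\mathbb E_\pi$ for the expectation over $x\sim\rho$, $y\sim\pi(\cdot\mid x)$ and $\mathrm{KL}(\pi)=\mathbb E_{x\sim\rho}\,\mathbb D_{\mathrm{KL}}(\pi(\cdot\mid x)\,\|\,\pi_{\mathrm{ref}}(\cdot\mid x))$; all policies below that are compared or optimized over have $\mathrm{KL}(\pi)<\infty$. There are $m\ge1$ objectives with known measurable features $\phi_i:\mathcal X\times\mathcal Y\to\mathbb R^d$ ($d\ge 1$), $\|\phi_i\|_2\le 1$, parameter spaces $$\Theta_i=\{\theta\in\mathbb R^d:\ \|\theta\|_2\le B,\ \langle\theta,\phi_i(x,y)\rangle\in[0,B]\ \forall x,y,\ \mathbb E_{\pi_{\mathrm{base}}}\langle\theta,\phi_i\rangle=C\},$$ and true rewards $r_i^*=\langle\theta_i^*,\phi_i\rangle$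 with $\theta_i^*\in\Theta_i$. Let $B'$ be such that $\|\theta\|_2\le B'$ for all $i$ and $\theta\in\Theta_i$, and put $r_i^\theta=\langle\theta_i,\phi_i\rangle$ for $\theta=(\theta_1,\dots,\theta_m)\in\Theta=\prod_i\Theta_i$. There are $N\ge1$ groups with weights $\zeta_n>0$, $\sum_n\zeta_n=1$, and target sets $$W^{(n)}=\Big\{z\in\mathbb R^m_{\ge0}:\Big(\sum_i\alpha^{(n)}_iz_i^{p^{(n)}}\Big)^{1/p^{(n)}}\ge c^{(n)}\Big\},\qquad \alpha^{(n)}\in\Delta_{m-1},\ p^{(n)}\in[-\infty,1],\ c^{(n)}\in\mathbb R,$$ with the usual limiting conventions for the power mean ($\min_i z_i$ for $p=-\infty$, the weighted geometric mean for $p=0$, and the value $0$ for $p<0$ if $z_i=0$ for some $i$ with $\alpha_i>0$). Let $S(\pi)_i=\mathbb E_\pi[r_i^*]-\beta\,\mathrm{KL}(\pi)$ and, for an integer $q\ge1$, with $d(\cdot,\cdot)$ the Euclidean distance, $$D_q(\pi)=\Big(\sum_{n=1}^N\zeta_n\,d^{2q}(S(\pi),W^{(n)})\Big)^{1/2q}.$$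 **Data.** For each objective $i$ there are $M\ge1$ prompts with pairs of responses, with an arbitrary joint distribution; conditionally on them the preference labels are independent and follow the Bradley–Terry model $\mathbb P(y_1\succ y_2\mid x)=\sigma(r_i^*(x,y_1)-r_i^*(x,y_2))$, $\sigma(z)=1/(1+e^{-z})$. This gives datasets $\mathcal D_i$ of $M$ triples $(x,y_w,y_l)$. Put $L_i(\theta_i)=-\sum_{\mathcal D_i}\log\sigma(r_i^\theta(x,y_w)-r_i^\theta(x,y_l))$ and $\Sigma_{\mathcal D_i}=\frac1M\sum_{\mathcal D_i}(\phi_i(x,y_w)-\phi_i(x,y_l))(\phi_i(x,y_w)-\phi_i(x,y_l))^\top$. **Algorithm.** Let $\eta=1/\sqrt M$ and $J(r^\theta,w,\pi)=\sum_iw_i(\mathbb E_\pi[r_i^\theta]-\beta\,\mathrm{KL}(\pi))$. In round $t=1,\dots,T$ ($T\ge1$), with the normalized direction $\overline{d^t}\in\Delta_{m-1}$: 1. $\theta^t$ is computed by the reward-based subroutine, $\theta^t\in\arg\max_{\theta\in\Theta}\{-\max_\pi J(r^\theta,\overline{d^t},\pi)-\eta\sum_iL_i(\theta_i)\}$, or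 by the reward-free one, $$\theta^t\in\arg\max_{\theta\in\Theta}\Big\{\beta\,\mathbb E_{\pi_{\mathrm{base}}}\log\tfrac{\pi^\theta(y\mid x)}{\pi_{\mathrm{ref}}(y\mid x)}+\eta\sum_i\sum_{\mathcal D_i}\log\sigma\Big(\beta\log\tfrac{\pi_{\theta_i}(y_w\mid x)}{\pi_{\mathrm{ref}}(y_w\mid x)}-\beta\log\tfrac{\pi_{\theta_i}(y_l\mid x)}{\pi_{\mathrm{ref}}(y_l\mid x)}\Big)\Big\},$$ where $\pi_{\theta_i}\propto\pi_{\mathrm{ref}}\,e^{r_i^\theta/\beta}$ and $\pi^\theta\propto\pi_{\mathrm{ref}}\,e^{\sum_i\overline{d^t_i}r_i^\theta/\beta}$; 2. $\pi^t\in\arg\max_\pi J(r^{\theta^t},\overline{d^t},\pi)$, $(V^t)_i=\mathbb E_{\pi^t}[r_i^{\theta^t}]-\beta\,\mathrm{KL}(\pi^t)$, $\overline V^t=\frac1t\sum_{j\le t}V^j$; 3. $\overline{d^{t+1}}=d^{t+1}/\|d^{t+1}\|_1$, where $$d^{t+1}=\sum_{n=1}^N\frac{\zeta_n\,d(\overline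 V^t,W^{(n)})^{2q-1}}{\big(\sum_{k}\zeta_k\,d(\overline V^t,W^{(k)})^{2q}\big)^{\frac{2q-1}{2q}}}\cdot\frac{\Pi_{W^{(n)}}(\overline V^t)-\overline V^t}{\|\Pi_{W^{(n)}}(\overline V^t)-\overline V^t\|_2}$$ ($\Pi_W$ is the projection onto $W$, and terms with $\overline V^t\in W^{(n)}$ are $0$). The first direction $\overline{d^1}$, and $\overline{d^{t+1}}$ when $d^{t+1}=0$, may be any element of $\Delta_{m-1}$; ties are broken arbitrarily. The algorithm returns $\tilde\pi^T=\frac1T\sum_{t=1}^T\pi^t$. **Theorem.** There are a polynomial $\mathrm{poly}$ in three variables, a constant $K$ and an exponent $k\in\mathbb N$, all universal, such that for all $\delta\in(0,1)$, with probability at least $1-\delta$ over the data, every run of the algorithm returns a policy with $\mathrm{KL}(\tilde\pi^T)<\infty$ and, for every policy $\pi^*$ (in particular for a minimizer of $D_q$), $$D_q(\tilde\pi^T)-D_q(\pi^*)\le\frac{N m^{3/2}\sqrt d}{\sqrt M}\,\mathrm{poly}\Big(e^{B'},\big(\min_i\lambda_{\min}(\Sigma_{\mathcal D_i})+\tfrac1M\big)^{-1},(\min_n\zeta_n)^{-1/2q}\Big)\Big(1+\log\frac{md}{\delta}\Big)^k+K\,B\sqrt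 m\,T^{-1/2q}\,(1+\log T)^k .$$ -/

import Mathlib

open MeasureTheory ProbabilityTheory
open scoped ENNReal

noncomputable section

namespace MORLHF

/-! ### Target sets, distances, projections -/

/-- The weighted `p`-mean `(∑ i, α i * z i ^ p) ^ (1 / p)` of a nonnegative vector, for an exponent
`p ∈ [-∞, 1]`, with the usual limiting conventions: it is the minimum for `p = -∞`, the weighted
geometric mean for `p = 0`, and `0` for `p < 0` when a coordinate of positive weight vanishes. -/
def powerMean {m : ℕ} (p : EReal) (α : Fin m → ℝ) (z : Fin m → ℝ) : ℝ :=
  open Classical in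
  if p = ⊥ then ⨅ i, z i
  else if p = 0 then ∏ i, z i ^ α i
  else if p < 0 ∧ ∃ i, 0 < α i ∧ z i = 0 then 0
  else (∑ i, α i * z i ^ p.toReal) ^ (1 / p.toReal)

/-- The target set `W^α_{p,c} = {z ≥ 0 : (∑ α_i z_i ^ p) ^ (1/p) ≥ c}`. -/
def targetSet {m : ℕ} (p : EReal) (α : Fin m → ℝ) (c : ℝ) : Set (EuclideanSpace ℝ (Fin m)) :=
  {z | (∀ i, 0 ≤ z i) ∧ c ≤ powerMean p α (fun i => z i)}

/-- The metric projection onto `W` (a nearest point of `W`; it exists and is unique when `W` is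
nonempty, closed and convex, as the target sets are). -/
def proj {m : ℕ} (W : Set (EuclideanSpace ℝ (Fin m))) (v : EuclideanSpace ℝ (Fin m)) :
    EuclideanSpace ℝ (Fin m) :=
  Classical.epsilon fun z => z ∈ W ∧ dist v z = Metric.infDist v W

/-- The unit vector pointing from `v` to its projection onto `W` (and `0` if `v` is its own
projection). -/
def projDir {m : ℕ} (W : Set (EuclideanSpace ℝ (Fin m))) (v : EuclideanSpace ℝ (Fin m)) :
    EuclideanSpace ℝ (Fin m) :=
  ‖proj W v - v‖⁻¹ • (proj W v - v)

/-- The `2q`-malfare `(∑ n, ζ n * d(v, W n) ^ (2q)) ^ (1 / (2q))` of a reward vector `v`. -/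
def malfare {m N : ℕ} (q : ℕ) (ζ : Fin N → ℝ) (W : Fin N → Set (EuclideanSpace ℝ (Fin m)))
    (v : EuclideanSpace ℝ (Fin m)) : ℝ :=
  (∑ n, ζ n * Metric.infDist v (W n) ^ (2 * q)) ^ (1 / (2 * (q : ℝ)))

/-- The aggregated malfare direction at the point `v` (for `q ≥ 1`). -/
def malfareDir {m N : ℕ} (q : ℕ) (ζ : Fin N → ℝ) (W : Fin N → Set (EuclideanSpace ℝ (Fin m)))
    (v : EuclideanSpace ℝ (Fin m)) : EuclideanSpace ℝ (Fin m) :=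
  ∑ n, (ζ n * Metric.infDist v (W n) ^ (2 * q - 1) /
      (∑ k, ζ k * Metric.infDist v (W k) ^ (2 * q)) ^ ((2 * (q : ℝ) - 1) / (2 * (q : ℝ)))) •
    projDir (W n) v

/-- The smallest eigenvalue of a real symmetric matrix. -/
def lambdaMin {d : ℕ} (A : Matrix (Fin d) (Fin d) ℝ) : ℝ := sInf (spectrum ℝ A)

/-! ### The model -/

/-- The `ρ`-averaged divergence `E_{x ∼ ρ} KL(π(· | x) ‖ π'(· | x))`. -/
def expKL {X Y : Type*} [MeasurableSpace X] [MeasurableSpace Y] (ρ : Measure X)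
    (π π' : Kernel X Y) : ℝ≥0∞ :=
  ∫⁻ x, InformationTheory.klDiv (π x) (π' x) ∂ρ

/-- `E_{x ∼ ρ, y ∼ π(· | x)} [f x y]`. -/
def expect {X Y : Type*} [MeasurableSpace X] [MeasurableSpace Y] (ρ : Measure X)
    (π : Kernel X Y) (f : X → Y → ℝ) : ℝ :=
  ∫ x, ∫ y, f x y ∂(π x) ∂ρ

/-- The parameter space of one objective with feature map `φ`: the parameters of norm at most `B`
whose linear reward takes values in `[0, B]` and has mean `C` under the baseline policy. -/
def paramSet {X Y : Type*} [MeasurableSpace X] [MeasurableSpace Y] {d : ℕ} (ρ : Measure X)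
    (πbase : Kernel X Y) (B C : ℝ) (φ : X → Y → EuclideanSpace ℝ (Fin d)) :
    Set (EuclideanSpace ℝ (Fin d)) :=
  {θ | ‖θ‖ ≤ B ∧ (∀ x y, inner ℝ θ (φ x y) ∈ Set.Icc 0 B) ∧
    expect ρ πbase (fun x y => inner ℝ θ (φ x y)) = C}

/-- A multi-objective, multi-group RLHF problem with `m` objectives, features in `ℝ^d` and
`N` groups. -/
structure Model (X Y : Type*) [MeasurableSpace X] [MeasurableSpace Y] (m d N : ℕ) where
  /-- prompt distribution -/
  ρ : Measure X
  isProb_ρ : IsProbabilityMeasure ρ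
  /-- reference policy -/
  πref : Kernel X Y
  isMarkov_ref : IsMarkovKernel πref
  /-- baseline policy -/
  πbase : Kernel X Y
  isMarkov_base : IsMarkovKernel πbase
  /-- regularization strength -/
  β : ℝ
  β_pos : 0 < β
  /-- bound on rewards and on parameters of the reward class -/
  B : ℝ
  one_le_B : 1 ≤ B
  /-- normalization constant of the rewards under the baseline policy -/
  C : ℝ
  /-- feature maps of the objectives -/
  φ : Fin m → X → Y → EuclideanSpace ℝ (Fin d)
  measurable_φ : ∀ i, Measurable (Function.uncurry (φ i))
  norm_φ_le : ∀ i x y, ‖φ i x y‖ ≤ 1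
  /-- true reward parameters -/
  θstar : Fin m → EuclideanSpace ℝ (Fin d)
  θstar_mem : ∀ i, θstar i ∈ paramSet ρ πbase B C (φ i)
  /-- upper bound on the norm of the parameters -/
  B' : ℝ
  norm_le_B' : ∀ i, ∀ θ ∈ paramSet ρ πbase B C (φ i), ‖θ‖ ≤ B'
  /-- exponent of each group -/
  p : Fin N → EReal
  p_le_one : ∀ n, p n ≤ 1
  /-- weights of the objectives for each group -/
  α : Fin N → Fin m → ℝ
  α_mem : ∀ n, α n ∈ stdSimplex ℝ (Fin m)
  /-- threshold of each group -/
  c : Fin N → ℝ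
  /-- weights of the groups -/
  ζ : Fin N → ℝ
  ζ_pos : ∀ n, 0 < ζ n
  ζ_sum : ∑ n, ζ n = 1

namespace Model

variable {X Y : Type*} [MeasurableSpace X] [MeasurableSpace Y] {m d N : ℕ}

/-- The linear reward `⟨θ i, φ i x y⟩` of objective `i`. -/
def reward (𝓜 : Model X Y m d N) (θ : Fin m → EuclideanSpace ℝ (Fin d)) (i : Fin m)
    (x : X) (y : Y) : ℝ :=
  inner ℝ (θ i) (𝓜.φ i x y)

/-- The joint parameter space. -/
def params (𝓜 : Model X Y m d N) : Set (Fin m → EuclideanSpace ℝ (Fin d)) :=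
  {θ | ∀ i, θ i ∈ paramSet 𝓜.ρ 𝓜.πbase 𝓜.B 𝓜.C (𝓜.φ i)}

/-- The target set of group `n`. -/
def W (𝓜 : Model X Y m d N) (n : Fin N) : Set (EuclideanSpace ℝ (Fin m)) :=
  targetSet (𝓜.p n) (𝓜.α n) (𝓜.c n)

/-- The policies: Markov kernels from prompts to responses with finite divergence from the reference
policy (for all other kernels every regularized value is `-∞`). -/
structure Policy (𝓜 : Model X Y m d N) where
  toKernel : Kernel X Y
  isMarkov : IsMarkovKernel toKernel
  finite_kl : expKL 𝓜.ρ toKernel 𝓜.πref ≠ ∞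

/-- The vector of regularized expected rewards `E_π[r_i^θ - β KL(π ‖ π_ref)]`. -/
def value (𝓜 : Model X Y m d N) (θ : Fin m → EuclideanSpace ℝ (Fin d)) (π : Kernel X Y) :
    EuclideanSpace ℝ (Fin m) :=
  WithLp.toLp 2 fun i =>
    expect 𝓜.ρ π (𝓜.reward θ i) - 𝓜.β * (expKL 𝓜.ρ π 𝓜.πref).toReal

/-- The true expected reward vector `S(π)`. -/
def S (𝓜 : Model X Y m d N) (π : Kernel X Y) : EuclideanSpace ℝ (Fin m) :=
  𝓜.value 𝓜.θstar π

/-- The malfare `D_q(π)` of a policy. -/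
def D (𝓜 : Model X Y m d N) (q : ℕ) (π : Kernel X Y) : ℝ :=
  malfare q 𝓜.ζ 𝓜.W (𝓜.S π)

/-- `J(r^θ, w, π) = E_π[∑ i, w i * (r_i^θ - β KL(π ‖ π_ref))]`. -/
def J (𝓜 : Model X Y m d N) (θ : Fin m → EuclideanSpace ℝ (Fin d)) (w : Fin m → ℝ)
    (π : 𝓜.Policy) : ℝ :=
  ∑ i, w i * 𝓜.value θ π.toKernel i

/-! ### Data -/

/-- The offline data: for each objective, `M` triples (prompt, winning response, losing
response). -/
abbrev Dataset (X Y : Type*) (m M : ℕ) : Type _ := Fin m → Fin M → X × Y × Y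

/-- The triple (prompt, winner, loser) for a prompt with two responses and a preference label
(`true` if the first response is preferred). -/
def ranked (a : X × Y × Y) (b : Bool) : X × Y × Y :=
  if b then a else (a.1, a.2.2, a.2.1)

/-- The Bradley-Terry probability of the label `b` at `a` for the reward function `r`. -/
def btProb (r : X → Y → ℝ) (a : X × Y × Y) (b : Bool) : ℝ :=
  Real.sigmoid (r (ranked a b).1 (ranked a b).2.1 - r (ranked a b).1 (ranked a b).2.2)

/-- The prompts and response pairs `A` are arbitrary random variables and, conditionally on them,
the preference labels `b` are independent and follow the Bradley-Terry model with reward `r`. -/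
structure IsBTData {Ω : Type*} [MeasurableSpace Ω] (P : Measure Ω) {M : ℕ} (r : X → Y → ℝ)
    (A : Fin M → Ω → X × Y × Y) (b : Fin M → Ω → Bool) : Prop where
  measurable_A : ∀ j, Measurable (A j)
  measurable_b : ∀ j, Measurable (b j)
  law : ∀ (E : Set (Fin M → X × Y × Y)) (s : Fin M → Bool), MeasurableSet E →
    P {ω | (fun j => A j ω) ∈ E ∧ ∀ j, b j ω = s j} =
      ∫⁻ ω in {ω | (fun j => A j ω) ∈ E}, ∏ j, ENNReal.ofReal (btProb r (A j ω) (s j)) ∂P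

/-- The empirical covariance matrix of the feature differences for objective `i`. -/
def covMatrix (𝓜 : Model X Y m d N) {M : ℕ} (D : Dataset X Y m M) (i : Fin m) :
    Matrix (Fin d) (Fin d) ℝ :=
  (M : ℝ)⁻¹ • ∑ j, Matrix.vecMulVec
    (fun k => 𝓜.φ i (D i j).1 (D i j).2.1 k - 𝓜.φ i (D i j).1 (D i j).2.2 k)
    (fun k => 𝓜.φ i (D i j).1 (D i j).2.1 k - 𝓜.φ i (D i j).1 (D i j).2.2 k)

/-- The negative log-likelihood `L_i(θ_i)`. -/
def L (𝓜 : Model X Y m d N) {M : ℕ} (D : Dataset X Y m M)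
    (θ : Fin m → EuclideanSpace ℝ (Fin d)) (i : Fin m) : ℝ :=
  -∑ j, Real.log (Real.sigmoid
    (𝓜.reward θ i (D i j).1 (D i j).2.1 - 𝓜.reward θ i (D i j).1 (D i j).2.2))

/-! ### The algorithm -/

/-- The reward-based objective `-max_π J(r^θ, w, π) - η ∑ i, L_i(θ_i)`, to be maximized. -/
def objRB (𝓜 : Model X Y m d N) {M : ℕ} (D : Dataset X Y m M) (η : ℝ) (w : Fin m → ℝ)
    (θ : Fin m → EuclideanSpace ℝ (Fin d)) : ℝ :=
  -(⨆ π : 𝓜.Policy, 𝓜.J θ w π) - ∑ i, η * 𝓜.L D θ i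

/-- The log-ratio `log (π(y | x) / π_ref(y | x))` of the policy
`π(· | x) ∝ π_ref(· | x) exp(f(x, ·) / β)`. -/
def logRatio (𝓜 : Model X Y m d N) (f : X → Y → ℝ) (x : X) (y : Y) : ℝ :=
  f x y / 𝓜.β - Real.log (∫ y', Real.exp (f x y' / 𝓜.β) ∂(𝓜.πref x))

/-- The reward-free objective, to be maximized: with `π_{θ_i} ∝ π_ref exp(r_i^θ / β)` and
`π^θ ∝ π_ref exp(∑ i, w i * r_i^θ / β)`, it is
`β E_{π_base}[log (π^θ / π_ref)] + η ∑ i, ∑ j, log σ(β log (π_{θ_i} / π_ref) (x_j, y_{w,j}) -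
β log (π_{θ_i} / π_ref) (x_j, y_{l,j}))`. -/
def objRF (𝓜 : Model X Y m d N) {M : ℕ} (D : Dataset X Y m M) (η : ℝ) (w : Fin m → ℝ)
    (θ : Fin m → EuclideanSpace ℝ (Fin d)) : ℝ :=
  𝓜.β * expect 𝓜.ρ 𝓜.πbase (𝓜.logRatio fun x y => ∑ i, w i * 𝓜.reward θ i x y) +
    η * ∑ i, ∑ j, Real.log (Real.sigmoid
      (𝓜.β * 𝓜.logRatio (𝓜.reward θ i) (D i j).1 (D i j).2.1 -
        𝓜.β * 𝓜.logRatio (𝓜.reward θ i) (D i j).1 (D i j).2.2))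

/-- The averaged estimated reward vector after `t` rounds. -/
def avgV (𝓜 : Model X Y m d N) (θ : ℕ → Fin m → EuclideanSpace ℝ (Fin d)) (π : ℕ → 𝓜.Policy)
    (t : ℕ) : EuclideanSpace ℝ (Fin m) :=
  (t : ℝ)⁻¹ • ∑ j ∈ Finset.Icc 1 t, 𝓜.value (θ j) (π j).toKernel

/-- A run of `T` rounds (`t = 1, …, T`) of the offline algorithm with the malfare direction, on the
data `D` and with `η = 1 / √M`: `w t` is the normalized direction, `θ t` the estimate and `π t` the
policy of round `t`. The first direction, and the direction after a round at which the aggregated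
direction vanishes, may be any element of the simplex; each estimate is computed by the
reward-based or by the reward-free subroutine; ties are broken arbitrarily. -/
structure IsRun (𝓜 : Model X Y m d N) {M : ℕ} (D : Dataset X Y m M) (q T : ℕ)
    (w : ℕ → Fin m → ℝ) (θ : ℕ → Fin m → EuclideanSpace ℝ (Fin d)) (π : ℕ → 𝓜.Policy) :
    Prop where
  dir_mem : ∀ t ∈ Finset.Icc 1 T, w t ∈ stdSimplex ℝ (Fin m)
  dir_eq : ∀ t, 1 ≤ t → t + 1 ≤ T → malfareDir q 𝓜.ζ 𝓜.W (𝓜.avgV θ π t) ≠ 0 →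
    ∀ i, w (t + 1) i = malfareDir q 𝓜.ζ 𝓜.W (𝓜.avgV θ π t) i /
      ∑ k, |malfareDir q 𝓜.ζ 𝓜.W (𝓜.avgV θ π t) k|
  est_mem : ∀ t ∈ Finset.Icc 1 T, θ t ∈ 𝓜.params
  est_max : ∀ t ∈ Finset.Icc 1 T,
    IsMaxOn (𝓜.objRB D (1 / √(M : ℝ)) (w t)) 𝓜.params (θ t) ∨
      IsMaxOn (𝓜.objRF D (1 / √(M : ℝ)) (w t)) 𝓜.params (θ t)
  greedy : ∀ t ∈ Finset.Icc 1 T, IsMaxOn (𝓜.J (θ t) (w t)) Set.univ (π t)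

/-- The returned policy `(1 / T) ∑ t, π t`. -/
def mixture (𝓜 : Model X Y m d N) (T : ℕ) (π : ℕ → 𝓜.Policy) : Kernel X Y where
  toFun x := (T : ℝ≥0∞)⁻¹ • ∑ t ∈ Finset.Icc 1 T, (π t).toKernel x
  measurable' := by
    refine Measure.measurable_of_measurable_coe _ fun s hs => ?_
    simp only [Measure.smul_apply, Measure.finsetSum_apply, smul_eq_mul]
    exact (Finset.measurable_sum _ fun t _ => (π t).toKernel.measurable_coe hs).const_mul _

end Model

end MORLHF

end

/-! The proof joins an approachability argument for the averages of the estimated values to a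
maximum likelihood bound for the parameters.

Geometry. Each target set is nonempty, closed, convex and closed under increasing coordinates
(`isUpperTarget_targetSet`). Let F be the malfare as a function of a reward vector. It decreases
when coordinates grow, it is 1-Lipschitz because the group weights sum to one, and minus the malfare
direction is a subgradient of it (`malfare_sub_inner_le`). The direction has nonnegative coordinates
and norm at most 1, and F² is smooth with a constant of order q (`malfare_add_sq_le`).

Optimization. Let u be the value vector of the comparator and f = F(u). Greedy optimality makes the
next value V at least as good as u along the current direction, up to √m times the parameter error
(`inner_malfareDir_ge`). Expanding F² at the running average and using the subgradient inequality, t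
F² grows per round by at most (f + ε)² + O(q B² m / t). Summing gives F ≤ f + ε + O(B √m √(q log T /
T)). The factor q is harmless when q ≤ 1 + log T; for larger q the rate T^(-1/2q) is at least 1/2
and boundedness suffices (`malfare_runAvg_le`).

Statistics. The non-likelihood term of either subroutine is Lipschitz in the parameters, so its
maximizer has nearly maximal likelihood (`sum_L_le_of_isMaxOn`). The logistic loss is strongly
convex on bounded margins, and the score at the truth is of order √(dM) up to a logarithm, by a
Chernoff bound over the labels (`exists_score_event`). Hence the parameter error is of order 1/√M,
uniformly over rounds and directions (`norm_sub_θstar_le`).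

Output. Convexity of the divergence makes the value of the mixture dominate the average of the
values, and F decreases under domination (`D_mixture_sub_le`). -/

namespace MORLHF

/-! ### Target sets are closed, convex and upper -/

/-- A nonempty closed convex set of reward vectors that is closed under increasing coordinates. -/
structure IsUpperTarget {m : ℕ} (W : Set (EuclideanSpace ℝ (Fin m))) : Prop where
  nonempty : W.Nonempty
  isClosed : IsClosed W
  convex : Convex ℝ W
  upper : ∀ z ∈ W, ∀ z' : EuclideanSpace ℝ (Fin m), (∀ i, z i ≤ z' i) → z' ∈ W

/-- The vectors `z ≥ 0` with `∑ i, α i * g (z i) ≥ s` and `z i ∈ S` for each `i` with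
`α i > 0`. -/
def levelSet {m : ℕ} (g : ℝ → ℝ) (S : Set ℝ) (α : Fin m → ℝ) (s : ℝ) :
    Set (EuclideanSpace ℝ (Fin m)) :=
  {z | (∀ i, 0 ≤ z i) ∧ (∀ i, 0 < α i → z i ∈ S) ∧ s ≤ ∑ i, α i * g (z i)}

section

variable {m : ℕ} {α : Fin m → ℝ}

/-- A weighted sum of concave functions of single coordinates is concave. Coordinates of weight zero
may leave `S`, where nothing is known of `g`, but their terms vanish. -/
theorem convex_levelSet {g : ℝ → ℝ} {S : Set ℝ} (hg : ConcaveOn ℝ S g) (hα : ∀ i, 0 ≤ α i)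
    (s : ℝ) : Convex ℝ (levelSet g S α s) := by
  rintro z ⟨hz0, hzS, hzs⟩ y ⟨hy0, hyS, hys⟩ a b ha hb hab
  refine ⟨fun i => ?_, fun i hi => ?_, ?_⟩
  · have := hz0 i
    have := hy0 i
    simp only [PiLp.add_apply, PiLp.smul_apply, smul_eq_mul]
    positivity
  · exact hg.1 (hzS i hi) (hyS i hi) ha hb hab
  · have key : ∀ i, a * (α i * g (z i)) + b * (α i * g (y i)) ≤
        α i * g ((a • z + b • y) i) := fun i => by
      rcases (hα i).eq_or_lt with h | h
      · simp [← h]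
      · have := hg.2 (hzS i h) (hyS i h) ha hb hab
        have := mul_le_mul_of_nonneg_left this (hα i)
        simp only [smul_eq_mul] at this
        calc _ = α i * (a * g (z i) + b * g (y i)) := by ring
          _ ≤ _ := this
    calc s = a * s + b * s := by rw [← add_mul, hab, one_mul]
      _ ≤ a * ∑ i, α i * g (z i) + b * ∑ i, α i * g (y i) := by gcongr
      _ = ∑ i, (a * (α i * g (z i)) + b * (α i * g (y i))) := by
        rw [Finset.mul_sum, Finset.mul_sum, Finset.sum_add_distrib]
      _ ≤ _ := Finset.sum_le_sum fun i _ => key i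

theorem levelSet_upper {g : ℝ → ℝ} {S : Set ℝ} (hg : MonotoneOn g S)
    (hS : ∀ x ∈ S, ∀ y, x ≤ y → y ∈ S) (hα : ∀ i, 0 ≤ α i) {s : ℝ}
    {z z' : EuclideanSpace ℝ (Fin m)} (hz : z ∈ levelSet g S α s) (h : ∀ i, z i ≤ z' i) :
    z' ∈ levelSet g S α s := by
  obtain ⟨h0, hzS, hs⟩ := hz
  refine ⟨fun i => (h0 i).trans (h i), fun i hi => hS _ (hzS i hi) _ (h i),
    hs.trans (Finset.sum_le_sum fun i _ => ?_)⟩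
  rcases (hα i).eq_or_lt with hi | hi
  · simp [← hi]
  · exact mul_le_mul_of_nonneg_left
      (hg (hzS i hi) (hS _ (hzS i hi) _ (h i)) (h i)) (hα i)

theorem powerMean_nonneg (hα : ∀ i, 0 ≤ α i) (p : EReal) {z : Fin m → ℝ} (hz : ∀ i, 0 ≤ z i) :
    0 ≤ powerMean p α z := by
  unfold powerMean
  split_ifs
  · exact Real.iInf_nonneg hz
  · exact Finset.prod_nonneg fun i _ => Real.rpow_nonneg (hz i) _
  · exact le_rfl
  · exact Real.rpow_nonneg
      (Finset.sum_nonneg fun i _ => mul_nonneg (hα i) (Real.rpow_nonneg (hz i) _)) _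

/-- Provides the point that makes a target set nonempty. The value `⊤` is excluded because its
`toReal` is 0. -/
theorem powerMean_const (hm : 1 ≤ m) (hα : α ∈ stdSimplex ℝ (Fin m)) {p : EReal} (hp : p ≠ ⊤)
    {c : ℝ} (hc : 0 < c) : powerMean p α (fun _ => c) = c := by
  have : NeZero m := ⟨by omega⟩
  unfold powerMean
  split_ifs with h1 h2 h3
  · exact ciInf_const
  · rw [← Real.rpow_sum_of_pos hc, hα.2, Real.rpow_one]
  · obtain ⟨-, i, -, hi⟩ := h3
    exact absurd hi hc.ne'
  · rw [← Finset.sum_mul, hα.2, one_mul, one_div, Real.rpow_rpow_inv hc.le]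
    lift p to ℝ using ⟨hp, h1⟩
    simpa using h2

theorem targetSet_of_nonpos (hα : ∀ i, 0 ≤ α i) (p : EReal) {c : ℝ} (hc : c ≤ 0) :
    targetSet p α c = {z | ∀ i, 0 ≤ z i} :=
  Set.ext fun _ => ⟨fun h => h.1, fun h => ⟨h, hc.trans (powerMean_nonneg hα p h)⟩⟩

theorem targetSet_bot (hm : 1 ≤ m) {c : ℝ} (hc : 0 < c) :
    targetSet ⊥ α c = {z | ∀ i, c ≤ z i} := by
  have : NeZero m := ⟨by omega⟩
  ext z
  simp only [targetSet, powerMean, if_true, Set.mem_ofPred_eq]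
  exact ⟨fun h i => h.2.trans (ciInf_le (Set.finite_range _).bddBelow i),
    fun h => ⟨fun i => hc.le.trans (h i), le_ciInf h⟩⟩

/-- Take logarithms. A vanishing coordinate of positive weight kills the product, so `c > 0` forces
positivity there; a coordinate of weight zero contributes the factor 1. -/
theorem targetSet_zero (hα : ∀ i, 0 ≤ α i) {c : ℝ} (hc : 0 < c) :
    targetSet 0 α c = levelSet Real.log (Set.Ioi 0) α (Real.log c) := by
  ext z
  have h0 : (0 : EReal) ≠ ⊥ := by simp
  simp only [targetSet, powerMean, h0, if_false, if_true, Set.mem_ofPred_eq, levelSet]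
  refine and_congr_right fun hz => ?_
  have key : (∀ i, 0 < α i → 0 < z i) → 0 < ∏ i, z i ^ α i ∧
      Real.log (∏ i, z i ^ α i) = ∑ i, α i * Real.log (z i) := fun h => by
    have hpos : ∀ i, 0 < z i ^ α i := fun i => by
      rcases (hα i).eq_or_lt with hi | hi
      · simp [← hi]
      · exact Real.rpow_pos_of_pos (h i hi) _
    refine ⟨Finset.prod_pos fun i _ => hpos i, ?_⟩
    rw [Real.log_prod fun i _ => (hpos i).ne']
    refine Finset.sum_congr rfl fun i _ => ?_
    rcases (hα i).eq_or_lt with hi | hi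
    · simp [← hi]
    · exact Real.log_rpow (h i hi) _
  constructor
  · intro h
    have hS : ∀ i, 0 < α i → 0 < z i := fun i hi => by
      refine (hz i).lt_of_ne fun h0 => ?_
      rw [Finset.prod_eq_zero (Finset.mem_univ i)
        (by rw [← h0, Real.zero_rpow hi.ne'])] at h
      exact absurd hc h.not_gt
    exact ⟨hS, (key hS).2 ▸ Real.log_le_log hc h⟩
  · rintro ⟨hS, h⟩
    rw [← (key hS).2] at h
    exact (Real.log_le_log_iff hc (key hS).1).1 h

theorem targetSet_pos (hα : ∀ i, 0 ≤ α i) {r : ℝ} (hr : 0 < r) {c : ℝ} (hc : 0 < c) :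
    targetSet (r : EReal) α c = levelSet (fun x => x ^ r) (Set.Ici 0) α (c ^ r) := by
  ext z
  have h1 : (r : EReal) ≠ ⊥ := by simp
  have h2 : (r : EReal) ≠ 0 := by exact_mod_cast hr.ne'
  have h3 : ¬ (r : EReal) < 0 := by exact_mod_cast hr.le.not_gt
  simp only [targetSet, powerMean, h1, h2, h3, if_false, false_and, Set.mem_ofPred_eq, levelSet,
    EReal.toReal_coe, one_div]
  refine and_congr_right fun hz => ?_
  rw [Real.le_rpow_inv_iff_of_pos hc.le
    (Finset.sum_nonneg fun i _ => mul_nonneg (hα i) (Real.rpow_nonneg (hz i) _)) hr]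
  exact ⟨fun h => ⟨fun i _ => hz i, h⟩, fun h => h.2⟩

/-- A negative power reverses the inequality, and the sign in front restores an increasing concave
function. The convention for zero coordinates is what puts the weighted ones in `Set.Ioi 0`. -/
theorem targetSet_neg (hα : α ∈ stdSimplex ℝ (Fin m)) {r : ℝ} (hr : r < 0) {c : ℝ} (hc : 0 < c) :
    targetSet (r : EReal) α c = levelSet (fun x => -x ^ r) (Set.Ioi 0) α (-c ^ r) := by
  ext z
  have h1 : (r : EReal) ≠ ⊥ := by simp
  have h2 : (r : EReal) ≠ 0 := by exact_mod_cast hr.ne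
  have h3 : (r : EReal) < 0 := by exact_mod_cast hr
  simp only [targetSet, powerMean, h1, h2, h3, if_false, true_and, Set.mem_ofPred_eq, levelSet,
    EReal.toReal_coe, one_div]
  refine and_congr_right fun hz => ?_
  obtain ⟨i₀, hi₀⟩ : ∃ i, 0 < α i := by
    by_contra! h
    have := Finset.sum_nonpos fun i (_ : i ∈ Finset.univ) => h i
    rw [hα.2] at this
    linarith
  split_ifs with h
  · obtain ⟨i, hi, hi0⟩ := h
    exact ⟨fun h => absurd hc h.not_gt, fun h => absurd (h.1 i hi) (by simp [hi0])⟩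
  · push Not at h
    have hS : ∀ i, 0 < α i → z i ∈ Set.Ioi (0 : ℝ) := fun i hi =>
      (hz i).lt_of_ne (h i hi).symm
    have hpos : 0 < ∑ i, α i * z i ^ r :=
      Finset.sum_pos' (fun i _ => mul_nonneg (hα.1 i) (Real.rpow_nonneg (hz i) _))
        ⟨i₀, Finset.mem_univ _, mul_pos hi₀ (Real.rpow_pos_of_pos (hS i₀ hi₀) _)⟩
    rw [Real.le_rpow_inv_iff_of_neg hc hpos hr]
    simp only [mul_neg, Finset.sum_neg_distrib, neg_le_neg_iff]
    exact ⟨fun h => ⟨hS, h⟩, fun h => h.2⟩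

/-- A negative power is not continuous at 0, but each single term of the sum is at most `c ^ r`,
which keeps every weighted coordinate above a positive bound `l i`. On the closed set `K` cut out by
these bounds the sum is continuous. -/
theorem isClosed_targetSet_neg (hα : α ∈ stdSimplex ℝ (Fin m)) {r : ℝ} (hr : r < 0) {c : ℝ}
    (hc : 0 < c) : IsClosed (targetSet (r : EReal) α c) := by
  let l : Fin m → ℝ := fun i => (c ^ r / α i) ^ r⁻¹
  have hcr : 0 < c ^ r := Real.rpow_pos_of_pos hc r
  let K : Set (EuclideanSpace ℝ (Fin m)) := {z | (∀ i, 0 ≤ z i) ∧ ∀ i, 0 < α i → l i ≤ z i}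
  have hK : IsClosed K := by
    simp only [K, Set.ofPred_and, Set.ofPred_forall]
    refine (isClosed_iInter fun i => isClosed_le (by fun_prop) (by fun_prop)).inter
      (isClosed_iInter fun i => isClosed_iInter fun _ => isClosed_le (by fun_prop) (by fun_prop))
  have hl : ∀ i, 0 < α i → 0 < l i := fun i hi => Real.rpow_pos_of_pos (div_pos hcr hi) _
  have hcont : ContinuousOn (fun z : EuclideanSpace ℝ (Fin m) => ∑ i, α i * z i ^ r) K := by
    refine continuousOn_finsetSum _ fun i _ => ?_
    rcases (hα.1 i).eq_or_lt with hi | hi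
    · simp only [← hi, zero_mul]
      exact continuousOn_const
    · refine continuousOn_const.mul (ContinuousOn.rpow_const (by fun_prop) fun z hz => ?_)
      exact Or.inl ((hl i hi).trans_le (hz.2 i hi)).ne'
  have : targetSet (r : EReal) α c =
      K ∩ (fun z : EuclideanSpace ℝ (Fin m) => ∑ i, α i * z i ^ r) ⁻¹' Set.Iic (c ^ r) := by
    rw [targetSet_neg hα hr hc]
    ext z
    simp only [levelSet, mul_neg, Finset.sum_neg_distrib, neg_le_neg_iff, Set.mem_ofPred_eq,
      Set.mem_inter_iff, Set.mem_preimage, Set.mem_Iic, K]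
    constructor
    · rintro ⟨h0, hS, hs⟩
      refine ⟨⟨h0, fun i hi => ?_⟩, hs⟩
      rw [Real.rpow_inv_le_iff_of_neg (div_pos hcr hi) (hS i hi) hr, le_div_iff₀ hi, mul_comm]
      exact (Finset.single_le_sum (f := fun i => α i * z i ^ r)
        (fun j _ => mul_nonneg (hα.1 j) (Real.rpow_nonneg (h0 j) _)) (Finset.mem_univ i)).trans hs
    · rintro ⟨⟨h0, hlz⟩, hs⟩
      exact ⟨h0, fun i hi => (hl i hi).trans_le (hlz i hi), hs⟩
  rw [this]
  exact hcont.preimage_isClosed_of_isClosed hK isClosed_Iic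

/-- The function is the increasing convex `exp` applied to the convex `r * log x`. -/
theorem convexOn_rpow_of_neg {r : ℝ} (hr : r < 0) :
    ConvexOn ℝ (Set.Ioi 0) fun x : ℝ => x ^ r := by
  have h : ConvexOn ℝ (Set.Ioi 0) fun x : ℝ => Real.exp (r * Real.log x) := by
    have hc : ConvexOn ℝ (Set.Ioi 0) fun x : ℝ => r * Real.log x := by
      have := (strictConcaveOn_log_Ioi.concaveOn).neg.smul (neg_nonneg.2 hr.le)
      refine this.congr fun x _ => ?_
      simp
    refine ⟨hc.1, fun x hx y hy a b ha hb hab => ?_⟩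
    exact (Real.exp_le_exp.2 (hc.2 hx hy ha hb hab)).trans
      (convexOn_exp.2 trivial trivial ha hb hab)
  refine h.congr fun x hx => ?_
  rw [Real.rpow_def_of_pos hx, mul_comm]

theorem isClosed_nonneg : IsClosed {z : EuclideanSpace ℝ (Fin m) | ∀ i, 0 ≤ z i} := by
  rw [Set.ofPred_forall]
  exact isClosed_iInter fun i => isClosed_le (by fun_prop) (by fun_prop)

theorem isUpperTarget_ge (c : ℝ) :
    IsUpperTarget {z : EuclideanSpace ℝ (Fin m) | ∀ i, c ≤ z i} where
  nonempty := ⟨WithLp.toLp 2 fun _ => c, fun _ => le_rfl⟩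
  isClosed := by
    rw [Set.ofPred_forall]
    exact isClosed_iInter fun i => isClosed_le (by fun_prop) (by fun_prop)
  convex := by
    intro z hz y hy a b ha hb hab i
    have h1 := mul_le_mul_of_nonneg_left (hz i) ha
    have h2 := mul_le_mul_of_nonneg_left (hy i) hb
    have h3 : c = a * c + b * c := by rw [← add_mul, hab, one_mul]
    simp only [PiLp.add_apply, PiLp.smul_apply, smul_eq_mul]
    linarith
  upper := fun z hz z' h i => (hz i).trans (h i)

theorem isUpperTarget_targetSet (hm : 1 ≤ m) (hα : α ∈ stdSimplex ℝ (Fin m)) {p : EReal}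
    (hp : p ≤ 1) (c : ℝ) : IsUpperTarget (targetSet p α c) := by
  rcases le_or_gt c 0 with hc | hc
  · rw [targetSet_of_nonpos hα.1 p hc]
    exact isUpperTarget_ge 0
  have hpt : p ≠ ⊤ := fun h => by
    rw [h] at hp
    exact absurd hp (by decide)
  have hne : (targetSet p α c).Nonempty :=
    ⟨WithLp.toLp 2 fun _ => c, fun _ => hc.le, (powerMean_const hm hα hpt hc).ge⟩
  by_cases hpb : p = ⊥
  · rw [hpb, targetSet_bot hm hc]
    exact isUpperTarget_ge c
  lift p to ℝ using ⟨hpt, hpb⟩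
  have hIoi : ∀ x ∈ Set.Ioi (0 : ℝ), ∀ y, x ≤ y → y ∈ Set.Ioi (0 : ℝ) :=
    fun x hx y hxy => lt_of_lt_of_le hx hxy
  rcases lt_trichotomy p 0 with h | h | h
  · refine ⟨hne, isClosed_targetSet_neg hα h hc, ?_, ?_⟩
    · rw [targetSet_neg hα h hc]
      exact convex_levelSet (convexOn_rpow_of_neg h).neg hα.1 _
    · rw [targetSet_neg hα h hc]
      exact fun z hz z' hzz' => levelSet_upper (fun x hx y hy hxy =>
        neg_le_neg (Real.rpow_le_rpow_of_nonpos hx hxy h.le)) hIoi hα.1 hz hzz'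
  · subst h
    rw [EReal.coe_zero] at hne ⊢
    refine ⟨hne, ?_, ?_, ?_⟩
    · have h0 : (0 : EReal) ≠ ⊥ := by simp
      simp only [targetSet, powerMean, h0, if_false, if_true, Set.ofPred_and]
      refine isClosed_nonneg.inter (isClosed_le continuous_const ?_)
      exact continuous_finsetProd _ fun i _ =>
        (Real.continuous_rpow_const (hα.1 i)).comp (by fun_prop)
    · rw [targetSet_zero hα.1 hc]
      exact convex_levelSet strictConcaveOn_log_Ioi.concaveOn hα.1 _
    · rw [targetSet_zero hα.1 hc]
      exact fun z hz z' hzz' => levelSet_upper (fun x hx y hy hxy =>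
        Real.log_le_log hx hxy) hIoi hα.1 hz hzz'
  · have hp1 : p ≤ 1 := by exact_mod_cast hp
    rw [targetSet_pos hα.1 h hc] at hne ⊢
    refine ⟨hne, ?_, convex_levelSet (Real.concaveOn_rpow h.le hp1) hα.1 _,
      fun z hz z' hzz' => levelSet_upper (fun x hx y hy hxy => Real.rpow_le_rpow hx hxy h.le)
        (fun x hx y hxy => le_trans hx hxy) hα.1 hz hzz'⟩
    have : levelSet (fun x => x ^ p) (Set.Ici 0) α (c ^ p) =
        {z | ∀ i, 0 ≤ z i} ∩ {z | c ^ p ≤ ∑ i, α i * z i ^ p} :=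
      Set.ext fun z => ⟨fun h => ⟨h.1, h.2.2⟩, fun h => ⟨h.1, fun i _ => h.1 i, h.2⟩⟩
    rw [this]
    refine isClosed_nonneg.inter (isClosed_le continuous_const ?_)
    exact continuous_finsetSum _ fun i _ => continuous_const.mul
      ((Real.continuous_rpow_const h.le).comp (by fun_prop))

end

end MORLHF

noncomputable section

namespace MORLHF

/-! ### Weighted `ℓ^p` norms -/

/-- The weighted norm `(∑ n, ζ n * a n ^ p) ^ (1 / p)` for a natural exponent. -/
def wNorm {N : ℕ} (p : ℕ) (ζ a : Fin N → ℝ) : ℝ :=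
  (∑ n, ζ n * a n ^ p) ^ (1 / (p : ℝ))

section wNorm

variable {N p : ℕ} {ζ a b : Fin N → ℝ}

theorem sum_weight_pow_nonneg (hζ : ∀ n, 0 ≤ ζ n) (ha : ∀ n, 0 ≤ a n) (p : ℕ) :
    0 ≤ ∑ n, ζ n * a n ^ p :=
  Finset.sum_nonneg fun n _ => mul_nonneg (hζ n) (pow_nonneg (ha n) p)

theorem wNorm_nonneg (hζ : ∀ n, 0 ≤ ζ n) (ha : ∀ n, 0 ≤ a n) : 0 ≤ wNorm p ζ a :=
  Real.rpow_nonneg (sum_weight_pow_nonneg hζ ha p) _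

theorem wNorm_pow (hp : 1 ≤ p) (hζ : ∀ n, 0 ≤ ζ n) (ha : ∀ n, 0 ≤ a n) :
    wNorm p ζ a ^ p = ∑ n, ζ n * a n ^ p := by
  rw [wNorm, one_div, Real.rpow_inv_natCast_pow (sum_weight_pow_nonneg hζ ha p) (by omega)]

theorem wNorm_mono (hp : 1 ≤ p) (hζ : ∀ n, 0 ≤ ζ n) (ha : ∀ n, 0 ≤ a n) (h : ∀ n, a n ≤ b n) :
    wNorm p ζ a ≤ wNorm p ζ b := by
  have := sum_weight_pow_nonneg hζ ha p
  unfold wNorm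
  gcongr with n
  · exact hζ n
  · exact ha n
  · exact h n

theorem wNorm_one (hζ1 : ∑ n, ζ n = 1) : wNorm p ζ (fun _ => 1) = 1 := by
  simp [wNorm, hζ1]

/-- Young's inequality with natural exponents: Bernoulli's inequality at `x / y - 1`, multiplied by
`y ^ p`. -/
theorem mul_pow_pred_le {p : ℕ} (hp : 1 ≤ p) {x y : ℝ} (hx : 0 ≤ x) (hy : 0 ≤ y) :
    p * (x * y ^ (p - 1)) ≤ x ^ p + (p - 1) * y ^ p := by
  obtain ⟨k, rfl⟩ := Nat.exists_eq_add_of_le' hp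
  rcases hy.eq_or_lt with rfl | hy
  · rcases k with _ | k
    · simp
    · simpa using pow_nonneg hx _
  · have h := one_add_mul_le_pow (a := x / y - 1) (by have := div_nonneg hx hy.le; linarith) (k + 1)
    rw [add_sub_cancel, div_pow, le_div_iff₀ (by positivity)] at h
    calc _ = (1 + ((k + 1 : ℕ) : ℝ) * (x / y - 1)) * y ^ (k + 1) +
          (((k + 1 : ℕ) : ℝ) - 1) * y ^ (k + 1) := by
          rw [Nat.add_sub_cancel]
          field_simp
          ring
      _ ≤ _ := by linarith

/-- Hölder's inequality for the exponents `p` and `p / (p - 1)`. -/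
theorem sum_mul_pow_pred_le (hp : 1 ≤ p) (hζ : ∀ n, 0 ≤ ζ n) (ha : ∀ n, 0 ≤ a n)
    (hb : ∀ n, 0 ≤ b n) :
    ∑ n, ζ n * (a n * b n ^ (p - 1)) ≤ wNorm p ζ a * wNorm p ζ b ^ (p - 1) := by
  have key : ∀ c : Fin N → ℝ, (∀ n, 0 ≤ c n) → wNorm p ζ c = 0 → ∀ n, ζ n = 0 ∨ c n = 0 :=
      fun c hc h n => by
    have h1 := wNorm_pow hp hζ hc
    rw [h, zero_pow (by omega), eq_comm,
      Finset.sum_eq_zero_iff_of_nonneg fun n _ => mul_nonneg (hζ n) (pow_nonneg (hc n) p)] at h1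
    simpa [show p ≠ 0 by omega] using h1 n (Finset.mem_univ n)
  rcases (wNorm_nonneg (p := p) hζ ha).eq_or_lt with hA | hA
  · rw [← hA, zero_mul]
    refine (Finset.sum_eq_zero fun n _ => ?_).le
    rcases key a ha hA.symm n with h | h <;> simp [h]
  -- For `p = 1` the factor `b n ^ 0` is 1 even where `b` vanishes, so this case must precede the
  -- degenerate one below.
  rcases hp.eq_or_lt with rfl | hp2
  · have := wNorm_pow le_rfl hζ ha
    simp only [pow_one] at this
    simp [this]
  rcases (wNorm_nonneg (p := p) hζ hb).eq_or_lt with hB | hB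
  · rw [← hB, zero_pow (by omega), mul_zero]
    refine (Finset.sum_eq_zero fun n _ => ?_).le
    rcases key b hb hB.symm n with h | h
    · simp [h]
    · simp [h, show p - 1 ≠ 0 by omega]
  set s := wNorm p ζ a with hs
  set t := wNorm p ζ b with ht
  have hpp : (0 : ℝ) < p := by exact_mod_cast hp
  -- Young's inequality for the sequences normalized to norm one; the right side sums to `1 + (p -
  -- 1)`.
  have h1 : (p : ℝ) * ∑ n, ζ n * (a n / s * (b n / t) ^ (p - 1)) ≤ p := by
    calc (p : ℝ) * ∑ n, ζ n * (a n / s * (b n / t) ^ (p - 1))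
        = ∑ n, ζ n * (p * (a n / s * (b n / t) ^ (p - 1))) := by
          rw [Finset.mul_sum]
          exact Finset.sum_congr rfl fun n _ => by ring
      _ ≤ ∑ n, ζ n * ((a n / s) ^ p + (p - 1) * (b n / t) ^ p) :=
          Finset.sum_le_sum fun n _ => mul_le_mul_of_nonneg_left (mul_pow_pred_le hp
            (div_nonneg (ha n) hA.le) (div_nonneg (hb n) hB.le)) (hζ n)
      _ = (∑ n, ζ n * a n ^ p) / s ^ p + (p - 1) * ((∑ n, ζ n * b n ^ p) / t ^ p) := by
          rw [Finset.sum_div, Finset.sum_div, Finset.mul_sum, ← Finset.sum_add_distrib]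
          refine Finset.sum_congr rfl fun n _ => ?_
          rw [div_pow, div_pow]
          ring
      _ = p := by
          rw [← wNorm_pow hp hζ ha, ← wNorm_pow hp hζ hb, ← hs, ← ht, div_self (by positivity),
            div_self (by positivity)]
          ring
  have h2 : ∑ n, ζ n * (a n / s * (b n / t) ^ (p - 1)) ≤ 1 := by
    by_contra! h
    nlinarith
  have h3 : ∑ n, ζ n * (a n / s * (b n / t) ^ (p - 1)) =
      (∑ n, ζ n * (a n * b n ^ (p - 1))) / (s * t ^ (p - 1)) := by
    rw [Finset.sum_div]
    refine Finset.sum_congr rfl fun n _ => ?_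
    rw [div_pow]
    field_simp
  rw [h3, div_le_one (by positivity)] at h2
  exact h2

theorem sum_pow_pred_le (hp : 1 ≤ p) (hζ : ∀ n, 0 ≤ ζ n) (hζ1 : ∑ n, ζ n = 1)
    (hb : ∀ n, 0 ≤ b n) : ∑ n, ζ n * b n ^ (p - 1) ≤ wNorm p ζ b ^ (p - 1) := by
  simpa [wNorm_one hζ1] using sum_mul_pow_pred_le hp hζ (fun _ => zero_le_one) hb

/-- Minkowski's inequality for a constant: split one factor of `(a n + c) ^ p`, apply Hölder to both
halves and cancel `t ^ (p - 1)`. Total weight one gives the constant norm `c`. -/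
theorem wNorm_add_const_le (hp : 1 ≤ p) (hζ : ∀ n, 0 ≤ ζ n) (hζ1 : ∑ n, ζ n = 1)
    (ha : ∀ n, 0 ≤ a n) {c : ℝ} (hc : 0 ≤ c) :
    wNorm p ζ (fun n => a n + c) ≤ wNorm p ζ a + c := by
  have hac : ∀ n, 0 ≤ a n + c := fun n => add_nonneg (ha n) hc
  rcases (wNorm_nonneg (p := p) hζ hac).eq_or_lt with h | h
  · rw [← h]
    exact add_nonneg (wNorm_nonneg hζ ha) hc
  set t := wNorm p ζ fun n => a n + c with ht
  have h1 : t ^ p ≤ (wNorm p ζ a + c) * t ^ (p - 1) := by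
    rw [ht, wNorm_pow hp hζ hac, ← ht, add_mul]
    calc ∑ n, ζ n * (a n + c) ^ p
        = ∑ n, ζ n * (a n * (a n + c) ^ (p - 1)) + c * ∑ n, ζ n * (a n + c) ^ (p - 1) := by
          rw [Finset.mul_sum, ← Finset.sum_add_distrib]
          refine Finset.sum_congr rfl fun n _ => ?_
          obtain ⟨k, rfl⟩ := Nat.exists_eq_add_of_le' hp
          rw [Nat.add_sub_cancel]
          ring
      _ ≤ _ := add_le_add (sum_mul_pow_pred_le hp hζ ha hac)
          (mul_le_mul_of_nonneg_left (sum_pow_pred_le hp hζ hζ1 hac) hc)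
  have h2 : t ^ p = t * t ^ (p - 1) := by rw [← pow_succ', Nat.sub_add_cancel hp]
  rw [h2] at h1
  exact le_of_mul_le_mul_right h1 (by positivity)

theorem wNorm_sq_eq (hζ : ∀ n, 0 ≤ ζ n) {q : ℕ} (hq : 1 ≤ q) (ha : ∀ n, 0 ≤ a n) :
    wNorm q ζ (fun n => a n ^ 2) = wNorm (2 * q) ζ a ^ 2 := by
  have h1 := wNorm_pow hq hζ (fun n => sq_nonneg (a n))
  have h2 := wNorm_pow (p := 2 * q) (by omega) hζ ha
  have : wNorm q ζ (fun n => a n ^ 2) ^ q = (wNorm (2 * q) ζ a ^ 2) ^ q := by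
    rw [h1, ← pow_mul, h2]
    exact Finset.sum_congr rfl fun n _ => by rw [pow_mul]
  exact (pow_left_inj₀ (wNorm_nonneg hζ fun n => sq_nonneg (a n)) (sq_nonneg _) (by omega)).1 this

theorem sum_pow_two_mul_pred_le (hζ : ∀ n, 0 ≤ ζ n) (hζ1 : ∑ n, ζ n = 1) {q : ℕ} (hq : 1 ≤ q)
    (ha : ∀ n, 0 ≤ a n) :
    ∑ n, ζ n * (a n ^ 2) ^ (q - 1) ≤ (wNorm (2 * q) ζ a ^ 2) ^ (q - 1) := by
  rw [← wNorm_sq_eq hζ hq ha]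
  exact sum_pow_pred_le hq hζ hζ1 fun n => sq_nonneg (a n)

end wNorm

/-- A second-order upper bound for `x ^ q`. -/
theorem add_pow_le_of_sq_le {a b c η : ℝ} (ha : 0 ≤ a) (hab : 0 ≤ a + b) (hac : a ≤ c)
    (habc : a + b ≤ c) (hb : b ^ 2 ≤ 4 * η ^ 2 * c) {q : ℕ} (hq : 1 ≤ q) :
    (a + b) ^ q ≤ a ^ q + q * a ^ (q - 1) * b + 2 * q * (q - 1) * η ^ 2 * c ^ (q - 1) := by
  have hc : 0 ≤ c := ha.trans hac
  induction q, hq using Nat.le_induction with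
  | base => simp
  | succ q hq ih =>
    obtain ⟨k, rfl⟩ := Nat.exists_eq_add_of_le' hq
    simp only [Nat.add_sub_cancel] at ih ⊢
    have hk : (0 : ℝ) ≤ k := k.cast_nonneg
    push_cast at ih ⊢
    have hac' : a ^ k ≤ c ^ k := by gcongr
    -- The only new quadratic term, `(k + 1) * a ^ k * b ^ 2`, is absorbed through `b ^ 2 ≤ 4 * η ^
    -- 2 * c`.
    calc (a + b) ^ (k + 1 + 1) = (a + b) * (a + b) ^ (k + 1) := by ring
      _ ≤ (a + b) * (a ^ (k + 1) + (k + 1) * a ^ k * b +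
          2 * (k + 1) * (k + 1 - 1) * η ^ 2 * c ^ k) := mul_le_mul_of_nonneg_left ih hab
      _ = a ^ (k + 2) + (k + 1 + 1) * a ^ (k + 1) * b + (k + 1) * (a ^ k * b ^ 2) +
          (a + b) * (2 * (k + 1) * k * η ^ 2 * c ^ k) := by ring
      _ ≤ a ^ (k + 2) + (k + 1 + 1) * a ^ (k + 1) * b + (k + 1) * (c ^ k * (4 * η ^ 2 * c)) +
          c * (2 * (k + 1) * k * η ^ 2 * c ^ k) := by gcongr
      _ = _ := by ring

/-! ### Distances to target sets -/

namespace IsUpperTarget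

variable {m : ℕ} {W : Set (EuclideanSpace ℝ (Fin m))}

theorem proj_spec (hW : IsUpperTarget W) (v : EuclideanSpace ℝ (Fin m)) :
    proj W v ∈ W ∧ dist v (proj W v) = Metric.infDist v W := by
  obtain ⟨y, hy, h⟩ := hW.isClosed.exists_infDist_eq_dist hW.nonempty v
  exact Classical.epsilon_spec (p := fun z => z ∈ W ∧ dist v z = Metric.infDist v W) ⟨y, hy, h.symm⟩

theorem norm_proj_sub (hW : IsUpperTarget W) (v : EuclideanSpace ℝ (Fin m)) :
    ‖proj W v - v‖ = Metric.infDist v W := by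
  rw [← (hW.proj_spec v).2, dist_eq_norm, norm_sub_rev]

/-- The variational characterization of the projection onto a convex set. -/
theorem inner_proj_nonneg (hW : IsUpperTarget W) (v : EuclideanSpace ℝ (Fin m))
    {z : EuclideanSpace ℝ (Fin m)} (hz : z ∈ W) :
    0 ≤ inner ℝ (proj W v - v) (z - proj W v) := by
  have h := (norm_eq_iInf_iff_real_inner_le_zero hW.convex (u := v) (hW.proj_spec v).1).1 (by
    rw [← dist_eq_norm, (hW.proj_spec v).2, Metric.infDist_eq_iInf]
    simp [dist_eq_norm]) z hz
  rw [← neg_sub v, inner_neg_left]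
  linarith

theorem infDist_smul_projDir (hW : IsUpperTarget W) (v : EuclideanSpace ℝ (Fin m)) :
    Metric.infDist v W • projDir W v = proj W v - v := by
  rw [projDir, hW.norm_proj_sub]
  by_cases h : Metric.infDist v W = 0
  · rw [h, zero_smul, eq_comm, ← norm_eq_zero, hW.norm_proj_sub, h]
  · rw [smul_inv_smul₀ h]

theorem norm_projDir_le (v : EuclideanSpace ℝ (Fin m)) : ‖projDir W v‖ ≤ 1 := by
  rw [projDir, norm_smul, norm_inv, norm_norm]
  exact inv_mul_le_one

/-- Raising coordinate `i` of the projection stays in `W`; the variational inequality at that point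
is the sign of coordinate `i`. -/
theorem projDir_nonneg (hW : IsUpperTarget W) (v : EuclideanSpace ℝ (Fin m)) (i : Fin m) :
    0 ≤ projDir W v i := by
  have hz : proj W v + EuclideanSpace.single i (1 : ℝ) ∈ W := by
    refine hW.upper _ (hW.proj_spec v).1 _ fun j => ?_
    rw [PiLp.add_apply, PiLp.single_apply]
    split_ifs <;> simp
  have h := hW.inner_proj_nonneg v hz
  rw [add_sub_cancel_left, EuclideanSpace.inner_single_right] at h
  simp only [conj_trivial, one_mul] at h
  rw [projDir, PiLp.smul_apply, smul_eq_mul]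
  exact mul_nonneg (by positivity) h

/-- The subgradient inequality for the distance: `W` lies beyond the hyperplane through the
projection normal to `projDir W v`, and a functional of norm at most 1 bounds distances from below.
-/
theorem infDist_sub_inner_le (hW : IsUpperTarget W) (u v : EuclideanSpace ℝ (Fin m)) :
    Metric.infDist v W - inner ℝ (projDir W v) (u - v) ≤ Metric.infDist u W := by
  refine (Metric.le_infDist hW.nonempty).2 fun {z} hz => ?_
  have h1 : inner ℝ (projDir W v) (z - u) ≤ ‖z - u‖ :=
    (real_inner_le_norm _ _).trans (mul_le_of_le_one_left (norm_nonneg _) (norm_projDir_le v))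
  have h2 : 0 ≤ inner ℝ (projDir W v) (z - proj W v) := by
    rw [projDir, real_inner_smul_left]
    exact mul_nonneg (by positivity) (hW.inner_proj_nonneg v hz)
  have h3 : inner ℝ (projDir W v) (proj W v - v) = Metric.infDist v W := by
    rw [projDir, real_inner_smul_left, real_inner_self_eq_norm_sq, hW.norm_proj_sub]
    by_cases h : Metric.infDist v W = 0
    · simp [h]
    · field_simp
  have h4 : z - u = (z - proj W v) + (proj W v - v) - (u - v) := by abel
  rw [h4, inner_sub_right, inner_add_right, h3, ← h4] at h1
  rw [dist_eq_norm, norm_sub_rev]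
  linarith

/-- Translating the projection of `v` by `v' - v ≥ 0` gives a point of `W` equally far from `v'`. -/
theorem infDist_antitone (hW : IsUpperTarget W) {v v' : EuclideanSpace ℝ (Fin m)}
    (h : ∀ i, v i ≤ v' i) : Metric.infDist v' W ≤ Metric.infDist v W := by
  have hz : proj W v + (v' - v) ∈ W := hW.upper _ (hW.proj_spec v).1 _ fun i => by
    simpa using h i
  refine (Metric.infDist_le_dist_of_mem hz).trans_eq ?_
  rw [← hW.norm_proj_sub, dist_eq_norm, norm_sub_rev]
  congr 1
  abel

end IsUpperTarget

/-! ### The malfare -/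

section malfare

variable {m N q : ℕ} {ζ : Fin N → ℝ} {W : Fin N → Set (EuclideanSpace ℝ (Fin m))}

theorem malfare_eq_wNorm (v : EuclideanSpace ℝ (Fin m)) :
    malfare q ζ W v = wNorm (2 * q) ζ fun n => Metric.infDist v (W n) := by
  simp [malfare, wNorm]

theorem malfare_nonneg (hζ : ∀ n, 0 ≤ ζ n) (v : EuclideanSpace ℝ (Fin m)) :
    0 ≤ malfare q ζ W v := by
  rw [malfare_eq_wNorm]
  exact wNorm_nonneg hζ fun n => Metric.infDist_nonneg

theorem malfare_antitone (hq : 1 ≤ q) (hζ : ∀ n, 0 ≤ ζ n) (hW : ∀ n, IsUpperTarget (W n))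
    {v v' : EuclideanSpace ℝ (Fin m)} (h : ∀ i, v i ≤ v' i) :
    malfare q ζ W v' ≤ malfare q ζ W v := by
  rw [malfare_eq_wNorm, malfare_eq_wNorm]
  exact wNorm_mono (by omega) hζ (fun n => Metric.infDist_nonneg)
    fun n => (hW n).infDist_antitone h

/-- Every distance moves by at most `‖v' - v‖`, and a weighted norm of total weight one passes this
on with constant 1. This is why no power of the smallest group weight enters the final bound. -/
theorem malfare_le_add_norm (hq : 1 ≤ q) (hζ : ∀ n, 0 ≤ ζ n) (hζ1 : ∑ n, ζ n = 1)
    (v v' : EuclideanSpace ℝ (Fin m)) :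
    malfare q ζ W v' ≤ malfare q ζ W v + ‖v' - v‖ := by
  rw [malfare_eq_wNorm, malfare_eq_wNorm]
  refine (wNorm_mono (by omega) hζ (fun n => Metric.infDist_nonneg) fun n => ?_).trans
    (wNorm_add_const_le (by omega) hζ hζ1 (fun n => Metric.infDist_nonneg) (norm_nonneg (v' - v)))
  rw [← dist_eq_norm]
  exact Metric.infDist_le_infDist_add_dist

theorem malfareDir_eq (hq : 1 ≤ q) (hζ : ∀ n, 0 ≤ ζ n) (v : EuclideanSpace ℝ (Fin m)) :
    malfareDir q ζ W v = (malfare q ζ W v ^ (2 * q - 1))⁻¹ •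
      ∑ n, (ζ n * Metric.infDist v (W n) ^ (2 * q - 1)) • projDir (W n) v := by
  have : (∑ k, ζ k * Metric.infDist v (W k) ^ (2 * q)) ^ ((2 * (q : ℝ) - 1) / (2 * (q : ℝ))) =
      malfare q ζ W v ^ (2 * q - 1) := by
    rw [malfare, ← Real.rpow_mul_natCast
      (sum_weight_pow_nonneg hζ (fun n => Metric.infDist_nonneg) _), Nat.cast_sub (by omega)]
    congr 1
    push_cast
    ring
  rw [malfareDir, this, Finset.smul_sum]
  refine Finset.sum_congr rfl fun n _ => ?_
  rw [smul_smul, div_eq_inv_mul]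

theorem malfareDir_nonneg (hq : 1 ≤ q) (hζ : ∀ n, 0 ≤ ζ n) (hW : ∀ n, IsUpperTarget (W n))
    (v : EuclideanSpace ℝ (Fin m)) (i : Fin m) : 0 ≤ malfareDir q ζ W v i := by
  rw [malfareDir_eq hq hζ, PiLp.smul_apply, WithLp.ofLp_sum, Finset.sum_apply]
  refine smul_nonneg (inv_nonneg.2 (pow_nonneg (malfare_nonneg hζ v) _))
    (Finset.sum_nonneg fun n _ => ?_)
  rw [PiLp.smul_apply]
  exact smul_nonneg (mul_nonneg (hζ n) (pow_nonneg Metric.infDist_nonneg _))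
    ((hW n).projDir_nonneg v i)

/-- Here the normalizing factor is `0⁻¹ = 0`. -/
theorem malfareDir_eq_zero (hq : 1 ≤ q) (hζ : ∀ n, 0 ≤ ζ n) {v : EuclideanSpace ℝ (Fin m)}
    (h : malfare q ζ W v = 0) : malfareDir q ζ W v = 0 := by
  rw [malfareDir_eq hq hζ, h, zero_pow (by omega), inv_zero, zero_smul]

theorem norm_malfareDir_le (hq : 1 ≤ q) (hζ : ∀ n, 0 ≤ ζ n) (hζ1 : ∑ n, ζ n = 1)
    (v : EuclideanSpace ℝ (Fin m)) : ‖malfareDir q ζ W v‖ ≤ 1 := by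
  rw [malfareDir_eq hq hζ, norm_smul, norm_inv, norm_pow, Real.norm_eq_abs,
    abs_of_nonneg (malfare_nonneg hζ v)]
  refine inv_mul_le_one_of_le₀ ?_ (pow_nonneg (malfare_nonneg hζ v) _)
  refine (norm_sum_le _ _).trans (le_trans ?_ (malfare_eq_wNorm (q := q) (ζ := ζ) v ▸
    sum_pow_pred_le (p := 2 * q) (by omega) hζ hζ1 fun n => Metric.infDist_nonneg))
  refine Finset.sum_le_sum fun n _ => ?_
  have h0 : 0 ≤ ζ n * Metric.infDist v (W n) ^ (2 * q - 1) :=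
    mul_nonneg (hζ n) (pow_nonneg Metric.infDist_nonneg _)
  rw [norm_smul, Real.norm_eq_abs, abs_of_nonneg h0]
  exact mul_le_of_le_one_right h0 (IsUpperTarget.norm_projDir_le v)

/-- `-malfareDir` is a subgradient of the malfare. -/
theorem malfare_sub_inner_le (hq : 1 ≤ q) (hζ : ∀ n, 0 ≤ ζ n) (hW : ∀ n, IsUpperTarget (W n))
    (u v : EuclideanSpace ℝ (Fin m)) :
    malfare q ζ W v - inner ℝ (malfareDir q ζ W v) (u - v) ≤ malfare q ζ W u := by
  rcases (malfare_nonneg (q := q) (W := W) hζ v).eq_or_lt with h | h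
  · rw [malfareDir_eq_zero hq hζ h.symm, inner_zero_left, sub_zero, ← h]
    exact malfare_nonneg hζ u
  -- After scaling, the claim is the sum of the subgradient inequalities of the distances with
  -- weights `ζ n * d ^ (2 * q - 1)`; Hölder's inequality bounds the resulting mixed sum.
  have h1 : malfare q ζ W v ^ (2 * q - 1) * (malfare q ζ W v -
      inner ℝ (malfareDir q ζ W v) (u - v)) =
      ∑ n, ζ n * Metric.infDist v (W n) ^ (2 * q - 1) *
        (Metric.infDist v (W n) - inner ℝ (projDir (W n) v) (u - v)) := by
    rw [mul_sub, malfareDir_eq hq hζ, real_inner_smul_left, mul_inv_cancel_left₀ (by positivity),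
      sum_inner, ← pow_succ, Nat.sub_add_cancel (by omega : 1 ≤ 2 * q)]
    conv_lhs => rw [malfare_eq_wNorm, wNorm_pow (by omega) hζ fun n => Metric.infDist_nonneg]
    rw [← Finset.sum_sub_distrib]
    refine Finset.sum_congr rfl fun n _ => ?_
    rw [real_inner_smul_left, mul_sub, mul_assoc (ζ n) _ (Metric.infDist _ _), ← pow_succ,
      Nat.sub_add_cancel (by omega : 1 ≤ 2 * q)]
  have h2 : malfare q ζ W v ^ (2 * q - 1) * (malfare q ζ W v -
      inner ℝ (malfareDir q ζ W v) (u - v)) ≤ malfare q ζ W v ^ (2 * q - 1) * malfare q ζ W u := by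
    rw [h1, malfare_eq_wNorm v, malfare_eq_wNorm u, mul_comm (_ ^ _)]
    refine le_trans (Finset.sum_le_sum fun n _ => ?_) (sum_mul_pow_pred_le (p := 2 * q) (by omega) hζ
      (fun n => Metric.infDist_nonneg) fun n => Metric.infDist_nonneg)
    rw [mul_assoc]
    refine mul_le_mul_of_nonneg_left ?_ (hζ n)
    rw [mul_comm]
    exact mul_le_mul_of_nonneg_right ((hW n).infDist_sub_inner_le u v)
      (pow_nonneg Metric.infDist_nonneg _)
  exact le_of_mul_le_mul_left h2 (by positivity)

/-- The ratio is at most `exp (2 * (q - 1) * η / F) ≤ exp 2 < 8`. Steps small compared with `F / q`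
thus change the high power only by a constant. -/
theorem add_sq_pow_pred_le {q : ℕ} {F η : ℝ} (hF : 0 < F) (hη : 0 ≤ η) (h : q * η ≤ F) :
    ((F + η) ^ 2) ^ (q - 1) ≤ 8 * (F ^ 2) ^ (q - 1) := by
  have h1 : F + η = F * (1 + η / F) := by field_simp
  have h2 : 1 + η / F ≤ Real.exp (η / F) := by
    rw [add_comm]
    exact Real.add_one_le_exp _
  have hle : ((q - 1 : ℕ) : ℝ) * η ≤ F := le_trans (by gcongr; omega) h
  have h3 : ((1 + η / F) ^ 2) ^ (q - 1) ≤ 8 := by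
    calc ((1 + η / F) ^ 2) ^ (q - 1) ≤ (Real.exp (η / F) ^ 2) ^ (q - 1) := by gcongr
      _ = Real.exp (2 * (((q - 1 : ℕ) : ℝ) * η / F)) := by
        rw [← pow_mul, ← Real.exp_nat_mul]
        congr 1
        push_cast
        ring
      _ ≤ Real.exp (2 * 1) := by
        gcongr
        exact (div_le_one hF).2 hle
      _ ≤ 8 := by
        rw [two_mul, Real.exp_add]
        have := Real.exp_one_lt_d9
        have := Real.exp_pos 1
        nlinarith
  rw [h1, mul_pow, mul_pow, mul_comm]
  gcongr

/-- The square of the malfare is `32 q`-smooth. -/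
theorem malfare_add_sq_le (hq : 1 ≤ q) (hζ : ∀ n, 0 ≤ ζ n) (hζ1 : ∑ n, ζ n = 1)
    (hW : ∀ n, IsUpperTarget (W n)) (v h : EuclideanSpace ℝ (Fin m)) :
    malfare q ζ W (v + h) ^ 2 ≤ malfare q ζ W v ^ 2 -
      2 * malfare q ζ W v * inner ℝ (malfareDir q ζ W v) h + 16 * q * ‖h‖ ^ 2 := by
  have hq' : (1 : ℝ) ≤ q := by exact_mod_cast hq
  have hF0 := malfare_nonneg (q := q) (W := W) hζ v
  have hF0' := malfare_nonneg (q := q) (W := W) hζ (v + h)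
  have hη := norm_nonneg h
  -- When the malfare is at most `q * ‖h‖`, the Lipschitz bound already suffices. Otherwise the
  -- distances are expanded to second order.
  rcases le_or_gt (malfare q ζ W v) (q * ‖h‖) with hc | hc
  · have h1 : malfare q ζ W (v + h) ≤ malfare q ζ W v + ‖h‖ := by
      simpa using malfare_le_add_norm (W := W) hq hζ hζ1 v (v + h)
    have h2 : inner ℝ (malfareDir q ζ W v) h ≤ ‖h‖ := (real_inner_le_norm _ _).trans
      (mul_le_of_le_one_left hη (norm_malfareDir_le hq hζ hζ1 v))
    have h3 : malfare q ζ W v * inner ℝ (malfareDir q ζ W v) h ≤ malfare q ζ W v * ‖h‖ :=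
      mul_le_mul_of_nonneg_left h2 hF0
    have h4 : malfare q ζ W v * ‖h‖ ≤ q * ‖h‖ * ‖h‖ := mul_le_mul_of_nonneg_right hc hη
    have h5 : malfare q ζ W (v + h) ^ 2 ≤ (malfare q ζ W v + ‖h‖) ^ 2 := by gcongr
    nlinarith [mul_le_mul_of_nonneg_right hq' (sq_nonneg ‖h‖)]
  have hF : 0 < malfare q ζ W v := lt_of_le_of_lt (by positivity) hc
  set F := malfare q ζ W v with hFdef
  set F' := malfare q ζ W (v + h) with hFdef'
  set η := ‖h‖ with hηdef
  set I := inner ℝ (malfareDir q ζ W v) h with hI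
  let δ : Fin N → ℝ := fun n => Metric.infDist v (W n)
  -- The distance from `v + h` to `W n` is bounded by the distance to the old projection, whose
  -- square is exactly `δ n ^ 2 + b n`.
  let b : Fin N → ℝ := fun n => 2 * inner ℝ (v - proj (W n) v) h + η ^ 2
  have hδ : ∀ n, 0 ≤ δ n := fun n => Metric.infDist_nonneg
  have hδb : ∀ n, δ n ^ 2 + b n = ‖v + h - proj (W n) v‖ ^ 2 := fun n => by
    have : v + h - proj (W n) v = (v - proj (W n) v) + h := by abel
    rw [this, norm_add_sq_real, norm_sub_rev v, (hW n).norm_proj_sub]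
    ring
  have hdist : ∀ n, Metric.infDist (v + h) (W n) ≤ ‖v + h - proj (W n) v‖ := fun n => by
    rw [← dist_eq_norm]
    exact Metric.infDist_le_dist_of_mem ((hW n).proj_spec v).1
  have hle : ∀ n, ‖v + h - proj (W n) v‖ ≤ δ n + η := fun n => by
    have : v + h - proj (W n) v = (v - proj (W n) v) + h := by abel
    rw [this]
    refine (norm_add_le _ _).trans_eq ?_
    rw [norm_sub_rev v, (hW n).norm_proj_sub]
  have hterm : ∀ n, Metric.infDist (v + h) (W n) ^ (2 * q) ≤ (δ n ^ 2) ^ q +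
      q * (δ n ^ 2) ^ (q - 1) * b n + 2 * q * (q - 1) * η ^ 2 * ((δ n + η) ^ 2) ^ (q - 1) :=
      fun n => by
    have hsq : Metric.infDist (v + h) (W n) ^ 2 ≤ δ n ^ 2 + b n := by
      rw [hδb]
      exact pow_le_pow_left₀ Metric.infDist_nonneg (hdist n) 2
    rw [pow_mul]
    refine (pow_le_pow_left₀ (sq_nonneg _) hsq q).trans (add_pow_le_of_sq_le (sq_nonneg _)
      (by rw [hδb]; positivity) ?_ ?_ ?_ hq)
    · exact pow_le_pow_left₀ (hδ n) (by linarith) 2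
    · rw [hδb]
      exact pow_le_pow_left₀ (norm_nonneg _) (hle n) 2
    · have h1 : |inner ℝ (v - proj (W n) v) h| ≤ δ n * η := by
        refine (abs_real_inner_le_norm _ _).trans_eq ?_
        rw [norm_sub_rev v, (hW n).norm_proj_sub]
      have h2 : |b n| ≤ 2 * (δ n + η) * η := by
        have := abs_le.1 h1
        have := hδ n
        rw [abs_le]
        constructor <;> nlinarith
      calc b n ^ 2 = |b n| ^ 2 := (sq_abs _).symm
        _ ≤ (2 * (δ n + η) * η) ^ 2 := by gcongr
        _ = _ := by ring
  have hS0 : ∑ n, ζ n * (δ n ^ 2) ^ q = F ^ (2 * q) := by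
    rw [hFdef, malfare_eq_wNorm, wNorm_pow (by omega) hζ hδ]
    exact Finset.sum_congr rfl fun n _ => by rw [pow_mul]
  have hS1 : ∑ n, ζ n * ((δ n ^ 2) ^ (q - 1) * inner ℝ (v - proj (W n) v) h) =
      -((F ^ 2) ^ (q - 1) * F * I) := by
    have e1 : (F ^ 2) ^ (q - 1) * F = F ^ (2 * q - 1) := by
      rw [← pow_mul, ← pow_succ]
      congr 1
      omega
    rw [e1, hI, malfareDir_eq hq hζ, real_inner_smul_left, mul_inv_cancel_left₀ (by positivity),
      sum_inner, ← Finset.sum_neg_distrib]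
    refine Finset.sum_congr rfl fun n _ => ?_
    have e2 : Metric.infDist v (W n) ^ (2 * q - 1) = (δ n ^ 2) ^ (q - 1) * δ n := by
      rw [← pow_mul, ← pow_succ]
      congr 1
      omega
    rw [e2, ← neg_sub, ← (hW n).infDist_smul_projDir, inner_neg_left, real_inner_smul_left,
      real_inner_smul_left]
    ring
  have hS2 : ∑ n, ζ n * (δ n ^ 2) ^ (q - 1) ≤ (F ^ 2) ^ (q - 1) := by
    rw [hFdef, malfare_eq_wNorm]
    exact sum_pow_two_mul_pred_le hζ hζ1 hq hδ
  have hS3 : ∑ n, ζ n * ((δ n + η) ^ 2) ^ (q - 1) ≤ 8 * (F ^ 2) ^ (q - 1) := by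
    refine (sum_pow_two_mul_pred_le hζ hζ1 hq fun n => add_nonneg (hδ n) hη).trans
      (le_trans ?_ (add_sq_pow_pred_le hF hη hc.le))
    rw [hFdef, malfare_eq_wNorm]
    have := wNorm_nonneg (p := 2 * q) hζ fun n => add_nonneg (hδ n) hη
    gcongr
    exact wNorm_add_const_le (by omega) hζ hζ1 hδ hη
  have hmain : F' ^ (2 * q) ≤
      F ^ (2 * q) + q * ((F ^ 2) ^ (q - 1) * (-(2 * F * I) + 16 * q * η ^ 2)) := by
    calc F' ^ (2 * q) = ∑ n, ζ n * Metric.infDist (v + h) (W n) ^ (2 * q) := by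
          rw [hFdef', malfare_eq_wNorm, wNorm_pow (by omega) hζ fun n => Metric.infDist_nonneg]
      _ ≤ ∑ n, ζ n * ((δ n ^ 2) ^ q + q * (δ n ^ 2) ^ (q - 1) * b n +
          2 * q * (q - 1) * η ^ 2 * ((δ n + η) ^ 2) ^ (q - 1)) :=
        Finset.sum_le_sum fun n _ => mul_le_mul_of_nonneg_left (hterm n) (hζ n)
      _ = ∑ n, ζ n * (δ n ^ 2) ^ q +
          2 * q * ∑ n, ζ n * ((δ n ^ 2) ^ (q - 1) * inner ℝ (v - proj (W n) v) h) +
          q * η ^ 2 * ∑ n, ζ n * (δ n ^ 2) ^ (q - 1) +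
          2 * q * (q - 1) * η ^ 2 * ∑ n, ζ n * ((δ n + η) ^ 2) ^ (q - 1) := by
        simp only [Finset.mul_sum, ← Finset.sum_add_distrib]
        refine Finset.sum_congr rfl fun n _ => ?_
        simp only [b]
        ring
      _ ≤ F ^ (2 * q) + 2 * q * (-((F ^ 2) ^ (q - 1) * F * I)) +
          q * η ^ 2 * (F ^ 2) ^ (q - 1) +
          2 * q * (q - 1) * η ^ 2 * (8 * (F ^ 2) ^ (q - 1)) := by
        have : (0 : ℝ) ≤ q - 1 := by linarith
        rw [hS0, hS1]
        gcongr
      _ ≤ _ := by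
        have : 0 ≤ q * (F ^ 2) ^ (q - 1) * η ^ 2 := by positivity
        nlinarith
  -- The bound reads `F' ^ (2 * q) ≤ F ^ (2 * q) * (1 + q * ξ)`. By Bernoulli the last factor is at
  -- most `(1 + ξ) ^ q`, so the `q`-th root can be taken.
  set ξ := (-(2 * F * I) + 16 * q * η ^ 2) / F ^ 2 with hξ
  have e1 : q * ((F ^ 2) ^ (q - 1) * (-(2 * F * I) + 16 * q * η ^ 2)) =
      F ^ (2 * q) * (q * ξ) := by
    have : F ^ (2 * q) = (F ^ 2) ^ (q - 1) * F ^ 2 := by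
      rw [pow_mul, ← pow_succ, Nat.sub_add_cancel hq]
    rw [this, hξ]
    field_simp
  rw [e1] at hmain
  have h1 : F' ^ (2 * q) ≤ F ^ (2 * q) * (1 + q * ξ) := by linarith
  have h2 : 0 ≤ 1 + q * ξ := by
    have : 0 ≤ F ^ (2 * q) * (1 + q * ξ) := le_trans (by positivity) h1
    exact nonneg_of_mul_nonneg_right this (by positivity)
  have h3 : -1 ≤ ξ := by
    by_contra! hlt
    nlinarith
  have h4 : (F' ^ 2) ^ q ≤ (F ^ 2 * (1 + ξ)) ^ q := by
    rw [← pow_mul, mul_pow, ← pow_mul]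
    refine h1.trans (mul_le_mul_of_nonneg_left ?_ (by positivity))
    exact one_add_mul_le_pow (by linarith) q
  have h5 : F' ^ 2 ≤ F ^ 2 * (1 + ξ) :=
    (pow_le_pow_iff_left₀ (sq_nonneg _) (mul_nonneg (sq_nonneg _) (by linarith)) (by omega)).1 h4
  calc F' ^ 2 ≤ F ^ 2 * (1 + ξ) := h5
    _ = _ := by
      rw [hξ]
      field_simp
      ring

end malfare

end MORLHF

end

noncomputable section

namespace MORLHF

/-! ### The potential argument for running averages -/

theorem norm_le_sqrt_mul {m : ℕ} {v : EuclideanSpace ℝ (Fin m)} {c : ℝ} (hc : 0 ≤ c)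
    (h : ∀ i, |v i| ≤ c) : ‖v‖ ≤ √(m : ℝ) * c := by
  rw [EuclideanSpace.norm_eq]
  calc √(∑ i, ‖v i‖ ^ 2) ≤ √(∑ _i : Fin m, c ^ 2) := by
        gcongr with i
        exact h i
    _ = √(m : ℝ) * c := by
        rw [Finset.sum_const, Finset.card_univ, Fintype.card_fin, nsmul_eq_mul,
          Real.sqrt_mul (Nat.cast_nonneg m), Real.sqrt_sq hc]

theorem sum_le_sqrt_mul_norm {m : ℕ} (v : EuclideanSpace ℝ (Fin m)) :
    ∑ i, v i ≤ √(m : ℝ) * ‖v‖ := by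
  have h := real_inner_le_norm (WithLp.toLp 2 fun _ => 1 : EuclideanSpace ℝ (Fin m)) v
  have h1 : ‖(WithLp.toLp 2 fun _ => 1 : EuclideanSpace ℝ (Fin m))‖ ≤ √(m : ℝ) * 1 :=
    norm_le_sqrt_mul zero_le_one fun i => by simp
  rw [mul_one] at h1
  have h2 : inner ℝ (WithLp.toLp 2 fun _ => 1 : EuclideanSpace ℝ (Fin m)) v = ∑ i, v i := by
    simp [PiLp.inner_apply]
  rw [← h2]
  exact h.trans (mul_le_mul_of_nonneg_right h1 (norm_nonneg v))

/-- The average of `V 1, …, V t`. -/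
def runAvg {E : Type*} [AddCommGroup E] [Module ℝ E] (V : ℕ → E) (t : ℕ) : E :=
  (t : ℝ)⁻¹ • ∑ j ∈ Finset.Icc 1 t, V j

theorem runAvg_succ {E : Type*} [AddCommGroup E] [Module ℝ E] (V : ℕ → E) {t : ℕ} (ht : 1 ≤ t) :
    runAvg V (t + 1) = runAvg V t + ((t : ℝ) + 1)⁻¹ • (V (t + 1) - runAvg V t) := by
  have ht' : (t : ℝ) ≠ 0 := by positivity
  have ht1 : (t : ℝ) + 1 ≠ 0 := by positivity
  have hs : ∑ j ∈ Finset.Icc 1 t, V j = (t : ℝ) • runAvg V t := by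
    rw [runAvg, smul_inv_smul₀ ht']
  have h : runAvg V (t + 1) = ((t : ℝ) + 1)⁻¹ • ((t : ℝ) • runAvg V t + V (t + 1)) := by
    rw [← hs, ← Finset.sum_Icc_succ_top (by omega), runAvg]
    push_cast
    rfl
  rw [h]
  have e : runAvg V t = ((t : ℝ) + 1)⁻¹ • (((t : ℝ) + 1) • runAvg V t) :=
    (inv_smul_smul₀ ht1 _).symm
  conv_rhs => rw [e, ← smul_add]
  congr 1
  rw [inv_smul_smul₀ ht1]
  module

theorem abs_runAvg_apply_le {m : ℕ} {V : ℕ → EuclideanSpace ℝ (Fin m)} {c : ℝ} {T : ℕ}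
    {i : Fin m} (hT : 1 ≤ T) (h : ∀ t ∈ Finset.Icc 1 T, |V t i| ≤ c) : |runAvg V T i| ≤ c := by
  have hT' : (0 : ℝ) < T := by exact_mod_cast hT
  rw [runAvg, PiLp.smul_apply, WithLp.ofLp_sum, Finset.sum_apply, smul_eq_mul, abs_mul,
    abs_of_pos (inv_pos.2 hT'), inv_mul_le_iff₀ hT']
  refine (Finset.abs_sum_le_sum_abs _ _).trans ((Finset.sum_le_sum h).trans_eq ?_)
  simp

theorem runAvg_sub {E : Type*} [AddCommGroup E] [Module ℝ E] (V V' : ℕ → E) (t : ℕ) :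
    runAvg V t - runAvg V' t = runAvg (fun j => V j - V' j) t := by
  rw [runAvg, runAvg, runAvg, ← smul_sub, Finset.sum_sub_distrib]

/-- After division by `T`, the right side is part of the expansion of `(g + A / T + A * √(R / T)) ^
2`, whose other terms are nonnegative. -/
theorem le_add_of_sq_le {F g A R T : ℝ} (hg : 0 ≤ g) (hA : 0 ≤ A) (hR : 0 ≤ R) (hT : 0 < T)
    (h : T * F ^ 2 ≤ T * g ^ 2 + 2 * g * A + A ^ 2 * R) : F ≤ g + A / T + A * √(R / T) := by
  have h0 : 0 ≤ g + A / T + A * √(R / T) := by positivity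
  refine abs_le_of_sq_le_sq' ?_ h0 |>.2
  have h1 : F ^ 2 ≤ g ^ 2 + 2 * g * (A / T) + A ^ 2 * (R / T) := by
    refine le_of_mul_le_mul_left (h.trans_eq ?_) hT
    field_simp
  have h2 : √(R / T) ^ 2 = R / T := Real.sq_sqrt (by positivity)
  have h3 : 0 ≤ A / T := by positivity
  have h4 : 0 ≤ A * √(R / T) := by positivity
  nlinarith [mul_nonneg hg h4, mul_nonneg h3 h4]

section

variable {m N q : ℕ} {ζ : Fin N → ℝ} {W : Fin N → Set (EuclideanSpace ℝ (Fin m))}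

/-- Compare through the constant vector `B`: it dominates `u`, and `v` is within `2 * B * √m` of it.
-/
theorem malfare_le_add_of_le (hq : 1 ≤ q) (hζ : ∀ n, 0 ≤ ζ n) (hζ1 : ∑ n, ζ n = 1)
    (hW : ∀ n, IsUpperTarget (W n)) {B : ℝ} {u v : EuclideanSpace ℝ (Fin m)} (hB : 0 ≤ B)
    (hv : ∀ i, |v i| ≤ B) (hu : ∀ i, u i ≤ B) :
    malfare q ζ W v ≤ malfare q ζ W u + 2 * B * √(m : ℝ) := by
  let b : EuclideanSpace ℝ (Fin m) := WithLp.toLp 2 fun _ => B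
  have h1 : malfare q ζ W b ≤ malfare q ζ W u := malfare_antitone hq hζ hW hu
  have h2 := malfare_le_add_norm (W := W) hq hζ hζ1 b v
  have h3 : ‖v - b‖ ≤ √(m : ℝ) * (2 * B) := norm_le_sqrt_mul (by linarith) fun i => by
    have := abs_le.1 (hv i)
    rw [PiLp.sub_apply, abs_le]
    change -(2 * B) ≤ v i - B ∧ v i - B ≤ 2 * B
    constructor <;> linarith
  linarith

/-- The potential bound for averages whose increments do not point away from `u`, up to `ε`, along
the malfare direction. -/
theorem mul_malfare_runAvg_sq_le (hq : 1 ≤ q) (hζ : ∀ n, 0 ≤ ζ n) (hζ1 : ∑ n, ζ n = 1)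
    (hW : ∀ n, IsUpperTarget (W n)) {B ε : ℝ} {u : EuclideanSpace ℝ (Fin m)}
    {V : ℕ → EuclideanSpace ℝ (Fin m)} {T : ℕ} (hB : 0 ≤ B) (hε : 0 ≤ ε)
    (hV : ∀ t ∈ Finset.Icc 1 T, ∀ i, |V t i| ≤ B) (hu : ∀ i, u i ≤ B)
    (hdir : ∀ t, 1 ≤ t → t + 1 ≤ T →
      -ε ≤ inner ℝ (malfareDir q ζ W (runAvg V t)) (V (t + 1) - u))
    {t : ℕ} (ht : 1 ≤ t) (htT : t ≤ T) :
    t * malfare q ζ W (runAvg V t) ^ 2 ≤ (malfare q ζ W u + ε + 2 * B * √(m : ℝ)) ^ 2 +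
      (t - 1) * (malfare q ζ W u + ε) ^ 2 + 16 * q * (2 * B * √(m : ℝ)) ^ 2 * Real.log t := by
  have hf := malfare_nonneg (q := q) (W := W) hζ u
  have havg : ∀ s, 1 ≤ s → s ≤ T → ∀ i, |runAvg V s i| ≤ B := fun s h1 h2 i =>
    abs_runAvg_apply_le h1 fun j hj => hV j (Finset.Icc_subset_Icc_right h2 hj) i
  induction t, ht using Nat.le_induction with
  -- The first direction is arbitrary, so only the crude bound is available; it produces the first
  -- square in the statement.
  | base =>
    have h1 := malfare_le_add_of_le hq hζ hζ1 hW hB (havg 1 le_rfl htT) hu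
    have h2 := malfare_nonneg (q := q) (W := W) hζ (runAvg V 1)
    simp only [Nat.cast_one, one_mul, sub_self, zero_mul, add_zero, Real.log_one, mul_zero]
    gcongr
    linarith
  | succ t ht ih =>
    have ih := ih (by omega)
    have ht0 : (0 : ℝ) < t := by exact_mod_cast ht
    set v := runAvg V t with hv
    set F := malfare q ζ W v with hF
    set f := malfare q ζ W u with hfdef
    set A := 2 * B * √(m : ℝ) with hA
    have hF0 : 0 ≤ F := malfare_nonneg hζ v
    have hsm := malfare_add_sq_le hq hζ hζ1 hW v (((t : ℝ) + 1)⁻¹ • (V (t + 1) - v))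
    rw [← runAvg_succ V ht, norm_smul, inner_smul_right, Real.norm_eq_abs,
      abs_of_pos (by positivity : 0 < ((t : ℝ) + 1)⁻¹)] at hsm
    have hnorm : ‖V (t + 1) - v‖ ≤ A := by
      refine (norm_le_sqrt_mul (c := 2 * B) (by linarith) fun i => ?_).trans_eq (by ring)
      have h1 := abs_le.1 (hV (t + 1) (Finset.mem_Icc.2 ⟨by omega, htT⟩) i)
      have h2 := abs_le.1 (havg t ht (by omega) i)
      rw [PiLp.sub_apply, abs_le]
      constructor <;> linarith
    have hinner : F - f - ε ≤ inner ℝ (malfareDir q ζ W v) (V (t + 1) - v) := by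
      have h1 := hdir t ht htT
      have h2 := malfare_sub_inner_le hq hζ hW u v
      have : V (t + 1) - v = (V (t + 1) - u) + (u - v) := by abel
      rw [this, inner_add_right]
      linarith
    set I := inner ℝ (malfareDir q ζ W v) (V (t + 1) - v)
    -- With `g = f + ε`, the linear term costs `-2 * F * (F - g)`, and `2 * F * g ≤ F ^ 2 + g ^ 2`
    -- turns `(t + 1) * F ^ 2` into `t * F ^ 2 + g ^ 2`.
    have hstep : ((t : ℝ) + 1) * malfare q ζ W (runAvg V (t + 1)) ^ 2 ≤
        t * F ^ 2 + (f + ε) ^ 2 + 16 * q * A ^ 2 * ((t : ℝ) + 1)⁻¹ := by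
      have h1 : ((t : ℝ) + 1) * malfare q ζ W (runAvg V (t + 1)) ^ 2 ≤
          ((t : ℝ) + 1) * (F ^ 2 - 2 * F * (((t : ℝ) + 1)⁻¹ * I) +
            16 * q * (((t : ℝ) + 1)⁻¹ * ‖V (t + 1) - v‖) ^ 2) :=
        mul_le_mul_of_nonneg_left hsm (by positivity)
      have h2 : ((t : ℝ) + 1) * (F ^ 2 - 2 * F * (((t : ℝ) + 1)⁻¹ * I) +
            16 * q * (((t : ℝ) + 1)⁻¹ * ‖V (t + 1) - v‖) ^ 2) =
          (t + 1) * F ^ 2 - 2 * F * I + 16 * q * ‖V (t + 1) - v‖ ^ 2 * ((t : ℝ) + 1)⁻¹ := by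
        field_simp
      have h3 : F * (F - f - ε) ≤ F * I := mul_le_mul_of_nonneg_left hinner hF0
      have h4 : 16 * q * ‖V (t + 1) - v‖ ^ 2 * ((t : ℝ) + 1)⁻¹ ≤
          16 * q * A ^ 2 * ((t : ℝ) + 1)⁻¹ := by gcongr
      nlinarith [sq_nonneg (F - f - ε)]
    have hlog : ((t : ℝ) + 1)⁻¹ ≤ Real.log ((t : ℝ) + 1) - Real.log t := by
      rw [← Real.log_div (by positivity) (by positivity)]
      refine le_trans (le_of_eq ?_) (Real.one_sub_inv_le_log_of_pos (by positivity))
      field_simp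
      ring
    have hlog' : 16 * q * A ^ 2 * ((t : ℝ) + 1)⁻¹ ≤
        16 * q * A ^ 2 * (Real.log ((t : ℝ) + 1) - Real.log t) :=
      mul_le_mul_of_nonneg_left hlog (by positivity)
    push_cast
    linarith

theorem malfare_runAvg_le (hq : 1 ≤ q) (hζ : ∀ n, 0 ≤ ζ n) (hζ1 : ∑ n, ζ n = 1)
    (hW : ∀ n, IsUpperTarget (W n)) {B ε : ℝ} {u : EuclideanSpace ℝ (Fin m)}
    {V : ℕ → EuclideanSpace ℝ (Fin m)} {T : ℕ} (hT : 1 ≤ T) (hB : 0 ≤ B) (hε : 0 ≤ ε)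
    (hV : ∀ t ∈ Finset.Icc 1 T, ∀ i, |V t i| ≤ B) (hu : ∀ i, u i ≤ B)
    (hdir : ∀ t, 1 ≤ t → t + 1 ≤ T →
      -ε ≤ inner ℝ (malfareDir q ζ W (runAvg V t)) (V (t + 1) - u)) :
    malfare q ζ W (runAvg V T) ≤ malfare q ζ W u + ε +
      10 * (B * √(m : ℝ) * (T : ℝ) ^ (-(1 / (2 * (q : ℝ))))) * (1 + Real.log T) := by
  have hf := malfare_nonneg (q := q) (W := W) hζ u
  have hT1 : (1 : ℝ) ≤ T := by exact_mod_cast hT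
  have hT0 : (0 : ℝ) < T := by linarith
  have hq1 : (1 : ℝ) ≤ q := by exact_mod_cast hq
  have hl := Real.log_nonneg hT1
  have hBm : 0 ≤ B * √(m : ℝ) := by positivity
  -- For small `q` the smoothness factor is logarithmic and `T ^ (-1/2)` is below the claimed rate.
  -- For large `q` the rate is at least 1/2, by `exp x ≥ 1 + x`, and the crude bound is enough.
  rcases le_or_gt (q : ℝ) (1 + Real.log T) with hc | hc
  · have h := mul_malfare_runAvg_sq_le hq hζ hζ1 hW hB hε hV hu hdir hT le_rfl
    have h1 := le_add_of_sq_le (F := malfare q ζ W (runAvg V T)) (g := malfare q ζ W u + ε)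
      (A := 2 * B * √(m : ℝ)) (R := 1 + 16 * q * Real.log T) (T := T) (by linarith) (by positivity)
      (by positivity) hT0 (by linarith)
    have h2 : √((1 + 16 * q * Real.log T) / T) ≤ 4 * (1 + Real.log T) / √(T : ℝ) := by
      rw [Real.sqrt_div (by positivity)]
      gcongr
      rw [Real.sqrt_le_left (by positivity)]
      nlinarith [mul_le_mul_of_nonneg_right hc hl]
    have h3 : 1 / √(T : ℝ) ≤ (T : ℝ) ^ (-(1 / (2 * (q : ℝ)))) := by
      rw [Real.sqrt_eq_rpow, one_div, ← Real.rpow_neg hT0.le]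
      refine Real.rpow_le_rpow_of_exponent_le hT1 (neg_le_neg ?_)
      exact one_div_le_one_div_of_le (by norm_num) (by linarith)
    have h4 : 1 / (T : ℝ) ≤ 1 / √(T : ℝ) :=
      one_div_le_one_div_of_le (by positivity) ((Real.sqrt_le_left hT0.le).2 (by nlinarith))
    set R := (T : ℝ) ^ (-(1 / (2 * (q : ℝ))))
    have hR : 0 ≤ R := by positivity
    calc malfare q ζ W (runAvg V T) ≤ malfare q ζ W u + ε + 2 * B * √(m : ℝ) / T +
          2 * B * √(m : ℝ) * √((1 + 16 * q * Real.log T) / T) := h1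
      _ ≤ malfare q ζ W u + ε + 2 * B * √(m : ℝ) / T +
          2 * B * √(m : ℝ) * (4 * (1 + Real.log T) / √(T : ℝ)) := by gcongr
      _ = malfare q ζ W u + ε + 2 * (B * √(m : ℝ)) * (1 / T) +
          8 * (B * √(m : ℝ)) * (1 + Real.log T) * (1 / √(T : ℝ)) := by ring
      _ ≤ malfare q ζ W u + ε + 2 * (B * √(m : ℝ)) * R +
          8 * (B * √(m : ℝ)) * (1 + Real.log T) * R := by
        have := h4.trans h3
        gcongr
      _ ≤ _ := by nlinarith [mul_nonneg (mul_nonneg hBm hR) hl]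
  · have h1 := malfare_le_add_of_le hq hζ hζ1 hW hB
      (fun i => abs_runAvg_apply_le hT fun j hj => hV j hj i) hu
    have h2 : 1 / 2 ≤ (T : ℝ) ^ (-(1 / (2 * (q : ℝ)))) := by
      rw [Real.rpow_def_of_pos hT0]
      have : -(1 / 2) ≤ Real.log T * -(1 / (2 * (q : ℝ))) := by
        rw [mul_neg, neg_le_neg_iff, mul_one_div, div_le_div_iff₀ (by positivity) (by norm_num)]
        linarith
      calc (1 / 2 : ℝ) = -(1 / 2) + 1 := by norm_num
        _ ≤ Real.log T * -(1 / (2 * (q : ℝ))) + 1 := by linarith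
        _ ≤ _ := Real.add_one_le_exp _
    set R := (T : ℝ) ^ (-(1 / (2 * (q : ℝ))))
    have h3 : B * √(m : ℝ) * (1 / 2) ≤ B * √(m : ℝ) * R := mul_le_mul_of_nonneg_left h2 hBm
    nlinarith [mul_nonneg (mul_nonneg hBm (by linarith : 0 ≤ R)) hl]

end

end MORLHF

end

noncomputable section

namespace MORLHF

/-! ### Convexity and measurability of the divergence -/

section KL

open InformationTheory

variable {X Y : Type*} [MeasurableSpace X] [MeasurableSpace Y]

/-- Countable generation of `Y` supplies a jointly measurable density of the kernels and
measurability of the set where absolute continuity holds. -/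
theorem measurable_klDiv_kernel [MeasurableSpace.CountablyGenerated Y] (κ η : Kernel X Y)
    [IsFiniteKernel κ] [IsFiniteKernel η] : Measurable fun x => klDiv (κ x) (η x) := by
  classical
  have h : (fun x => klDiv (κ x) (η x)) = fun x =>
      if κ x ≪ η x then ∫⁻ y, ENNReal.ofReal (klFun (κ.rnDeriv η x y).toReal) ∂(η x) else ∞ := by
    ext x
    rw [klDiv_eq_lintegral_klFun]
    split_ifs with hx
    · refine lintegral_congr_ae ?_
      filter_upwards [Kernel.rnDeriv_eq_rnDeriv_measure (κ := κ) (η := η) (a := x)] with y hy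
      rw [hy]
    · rfl
  rw [h]
  refine Measurable.ite (Kernel.measurableSet_absolutelyContinuous κ η) ?_ measurable_const
  refine Measurable.lintegral_kernel_prod_right ?_
  exact ENNReal.measurable_ofReal.comp
    (measurable_klFun.comp (Kernel.measurable_rnDeriv κ η).ennreal_toReal)

theorem rnDeriv_finsetSum {ι : Type*} (s : Finset ι) (μ : ι → Measure Y) (ν : Measure Y)
    [∀ i, IsFiniteMeasure (μ i)] [IsFiniteMeasure ν] :
    (∑ i ∈ s, μ i).rnDeriv ν =ᵐ[ν] fun y => ∑ i ∈ s, (μ i).rnDeriv ν y := by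
  classical
  induction s using Finset.induction_on with
  | empty =>
    simp only [Finset.sum_empty]
    exact Measure.rnDeriv_zero ν
  | insert a s ha ih =>
    simp only [Finset.sum_insert ha]
    filter_upwards [Measure.rnDeriv_add' (μ a) (∑ i ∈ s, μ i) ν, ih] with y h1 h2
    rw [h1, Pi.add_apply, h2]

/-- Jensen's inequality for `klFun`, applied pointwise to the densities. If some `μ i` is not
absolutely continuous, the right side is infinite. -/
theorem klDiv_average_le {ι : Type*} {s : Finset ι} (hs : s.Nonempty) (μ : ι → Measure Y)
    (ν : Measure Y) [∀ i, IsFiniteMeasure (μ i)] [IsFiniteMeasure ν] :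
    klDiv ((s.card : ℝ≥0∞)⁻¹ • ∑ i ∈ s, μ i) ν ≤ (s.card : ℝ≥0∞)⁻¹ * ∑ i ∈ s, klDiv (μ i) ν := by
  have hc0 : (s.card : ℝ≥0∞) ≠ 0 := by simpa using hs.ne_empty
  have hct : (s.card : ℝ≥0∞) ≠ ∞ := ENNReal.natCast_ne_top _
  have hci : (s.card : ℝ≥0∞)⁻¹ ≠ ∞ := ENNReal.inv_ne_top.2 hc0
  by_cases hac : ∀ i ∈ s, μ i ≪ ν
  · have hsum : (∑ i ∈ s, μ i) ≪ ν := by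
      refine Measure.AbsolutelyContinuous.mk fun t _ ht => ?_
      rw [Measure.finsetSum_apply]
      exact Finset.sum_eq_zero fun i hi => hac i hi ht
    have hfin : IsFiniteMeasure ((s.card : ℝ≥0∞)⁻¹ • ∑ i ∈ s, μ i) :=
      Measure.smul_finite _ hci
    rw [klDiv_eq_lintegral_klFun_of_ac (hsum.smul_left _)]
    have hrhs : (s.card : ℝ≥0∞)⁻¹ * ∑ i ∈ s, klDiv (μ i) ν =
        ∫⁻ y, (s.card : ℝ≥0∞)⁻¹ * ∑ i ∈ s,
          ENNReal.ofReal (klFun ((μ i).rnDeriv ν y).toReal) ∂ν := by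
      have hm : ∀ i, Measurable fun y => ENNReal.ofReal (klFun ((μ i).rnDeriv ν y).toReal) :=
        fun i => by fun_prop
      rw [lintegral_const_mul _ (Finset.measurable_fun_sum _ fun i _ => hm i),
        lintegral_finsetSum _ fun i _ => hm i]
      congr 1
      exact Finset.sum_congr rfl fun i hi => klDiv_eq_lintegral_klFun_of_ac (hac i hi)
    rw [hrhs]
    refine lintegral_mono_ae ?_
    have hlt : ∀ᵐ y ∂ν, ∀ i ∈ s, (μ i).rnDeriv ν y < ∞ :=
      (Finset.eventually_all s).2 fun i _ => Measure.rnDeriv_lt_top (μ i) ν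
    filter_upwards [Measure.rnDeriv_smul_left_of_ne_top' (∑ i ∈ s, μ i) ν hci,
      rnDeriv_finsetSum s μ ν, hlt] with y h1 h2 h3
    rw [h1, Pi.smul_apply, h2, smul_eq_mul, ENNReal.toReal_mul, ENNReal.toReal_sum
      (fun i hi => (h3 i hi).ne), ENNReal.toReal_inv, ENNReal.toReal_natCast, Finset.mul_sum]
    have hcr : (0 : ℝ) < s.card := by exact_mod_cast hs.card_pos
    have hJ := convexOn_klFun.map_sum_le (t := s) (w := fun _ => (s.card : ℝ)⁻¹)
      (p := fun i => ((μ i).rnDeriv ν y).toReal) (fun i _ => by positivity)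
      (by simp [hcr.ne']) (fun i _ => ENNReal.toReal_nonneg)
    simp only [smul_eq_mul] at hJ
    refine (ENNReal.ofReal_le_ofReal hJ).trans_eq ?_
    rw [← Finset.mul_sum, ENNReal.ofReal_mul (by positivity), ENNReal.ofReal_inv_of_pos hcr,
      ENNReal.ofReal_natCast, ENNReal.ofReal_sum_of_nonneg
      fun i _ => klFun_nonneg ENNReal.toReal_nonneg]
  · push Not at hac
    obtain ⟨i, hi, hn⟩ := hac
    have : ∑ i ∈ s, klDiv (μ i) ν = ∞ :=
      ENNReal.sum_eq_top.2 ⟨i, hi, klDiv_of_not_ac hn⟩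
    rw [this, ENNReal.mul_top (ENNReal.inv_ne_zero.2 hct)]
    exact le_top

end KL

/-! ### Expectations of bounded functions -/

section expect

variable {X Y : Type*} [MeasurableSpace X] [MeasurableSpace Y] {ρ : Measure X}
  [IsProbabilityMeasure ρ] {π : Kernel X Y} [IsMarkovKernel π] {f g : X → Y → ℝ} {c : ℝ}

theorem integrable_section (hf : Measurable (Function.uncurry f)) (hc : ∀ x y, |f x y| ≤ c)
    (x : X) : Integrable (f x) (π x) :=
  Integrable.of_bound (hf.comp measurable_prodMk_left).aestronglyMeasurable c
    (ae_of_all _ fun y => hc x y)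

theorem measurable_integral_section (hf : Measurable (Function.uncurry f)) :
    Measurable fun x => ∫ y, f x y ∂(π x) :=
  (hf.stronglyMeasurable.integral_kernel_prod_right (κ := π)).measurable

theorem abs_integral_section_le (hc : ∀ x y, |f x y| ≤ c) (x : X) :
    |∫ y, f x y ∂(π x)| ≤ c := by
  simpa using norm_integral_le_of_norm_le_const (μ := π x) (f := f x) (C := c)
    (ae_of_all _ fun y => hc x y)

theorem integrable_integral_section (hf : Measurable (Function.uncurry f))
    (hc : ∀ x y, |f x y| ≤ c) : Integrable (fun x => ∫ y, f x y ∂(π x)) ρ :=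
  Integrable.of_bound (measurable_integral_section hf).aestronglyMeasurable c
    (ae_of_all _ fun x => abs_integral_section_le hc x)

theorem abs_expect_le (hc : ∀ x y, |f x y| ≤ c) : |expect ρ π f| ≤ c := by
  simpa [expect] using norm_integral_le_of_norm_le_const (μ := ρ)
    (f := fun x => ∫ y, f x y ∂(π x)) (C := c)
    (ae_of_all _ fun x => abs_integral_section_le (π := π) hc x)

theorem abs_expect_sub_expect_le {C : ℝ} (hf : Measurable (Function.uncurry f))
    (hg : Measurable (Function.uncurry g)) (hfC : ∀ x y, |f x y| ≤ C) (hgC : ∀ x y, |g x y| ≤ C)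
    (h : ∀ x y, |f x y - g x y| ≤ c) : |expect ρ π f - expect ρ π g| ≤ c := by
  have : expect ρ π f - expect ρ π g = expect ρ π fun x y => f x y - g x y := by
    unfold expect
    rw [← integral_sub (integrable_integral_section hf hfC) (integrable_integral_section hg hgC)]
    exact integral_congr_ae (ae_of_all _ fun x =>
      (integral_sub (integrable_section hf hfC x) (integrable_section hg hgC x)).symm)
  rw [this]
  exact abs_expect_le h

end expect

/-- From `f ≤ g + c` follows `∫ exp f ≤ exp c * ∫ exp g`; symmetry gives the other side. -/
theorem abs_log_integral_exp_sub_le {Y : Type*} [MeasurableSpace Y] {μ : Measure Y}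
    [IsProbabilityMeasure μ] {f g : Y → ℝ} {C c : ℝ} (hf : Measurable f) (hg : Measurable g)
    (hfC : ∀ y, |f y| ≤ C) (hgC : ∀ y, |g y| ≤ C) (h : ∀ y, |f y - g y| ≤ c) :
    |Real.log (∫ y, Real.exp (f y) ∂μ) - Real.log (∫ y, Real.exp (g y) ∂μ)| ≤ c := by
  have hint : ∀ {f : Y → ℝ}, Measurable f → (∀ y, |f y| ≤ C) →
      Integrable (fun y => Real.exp (f y)) μ := fun hf hfC =>
    Integrable.of_bound hf.exp.aestronglyMeasurable (Real.exp C) (ae_of_all _ fun y => by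
      rw [Real.norm_eq_abs, Real.abs_exp, Real.exp_le_exp]
      exact (le_abs_self _).trans (hfC y))
  have hpos : ∀ {f : Y → ℝ}, Measurable f → (∀ y, |f y| ≤ C) →
      0 < ∫ y, Real.exp (f y) ∂μ := fun hf hfC => integral_exp_pos (hint hf hfC)
  have hone : ∀ {f g : Y → ℝ}, Measurable f → Measurable g → (∀ y, |f y| ≤ C) →
      (∀ y, |g y| ≤ C) → (∀ y, |f y - g y| ≤ c) →
      Real.log (∫ y, Real.exp (f y) ∂μ) ≤ c + Real.log (∫ y, Real.exp (g y) ∂μ) :=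
      fun {f g} hf hg hfC hgC h => by
    have h1 : ∫ y, Real.exp (f y) ∂μ ≤ Real.exp c * ∫ y, Real.exp (g y) ∂μ := by
      rw [← integral_const_mul]
      refine integral_mono (hint hf hfC) ((hint hg hgC).const_mul _) fun y => ?_
      simp only
      rw [← Real.exp_add, Real.exp_le_exp]
      linarith [(abs_le.1 (h y)).2]
    have h2 := Real.log_le_log (hpos hf hfC) h1
    rwa [Real.log_mul (Real.exp_pos c).ne' (hpos hg hgC).ne', Real.log_exp] at h2
  have h1 := hone hf hg hfC hgC h
  have h2 := hone hg hf hgC hfC fun y => by rw [abs_sub_comm]; exact h y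
  rw [abs_le]
  constructor <;> linarith

/-! ### Rewards, values and the two estimation subroutines -/

namespace Model

variable {X Y : Type*} [MeasurableSpace X] [MeasurableSpace Y] {m d N : ℕ}

instance (𝓜 : Model X Y m d N) : IsProbabilityMeasure 𝓜.ρ := 𝓜.isProb_ρ

instance (𝓜 : Model X Y m d N) : IsMarkovKernel 𝓜.πref := 𝓜.isMarkov_ref

instance (𝓜 : Model X Y m d N) : IsMarkovKernel 𝓜.πbase := 𝓜.isMarkov_base

instance (𝓜 : Model X Y m d N) (π : 𝓜.Policy) : IsMarkovKernel π.toKernel := π.isMarkov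

theorem expKL_ref (𝓜 : Model X Y m d N) : expKL 𝓜.ρ 𝓜.πref 𝓜.πref = 0 := by
  simp [expKL]

instance (𝓜 : Model X Y m d N) : Nonempty 𝓜.Policy :=
  ⟨⟨𝓜.πref, 𝓜.isMarkov_ref, by simp [expKL_ref]⟩⟩

section reward

variable (𝓜 : Model X Y m d N) {θ θ' : Fin m → EuclideanSpace ℝ (Fin d)}

theorem measurable_reward (θ : Fin m → EuclideanSpace ℝ (Fin d)) (i : Fin m) :
    Measurable (Function.uncurry (𝓜.reward θ i)) := by
  have h : Function.uncurry (𝓜.reward θ i) =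
      fun z => inner ℝ (θ i) (Function.uncurry (𝓜.φ i) z) := rfl
  rw [h]
  exact (𝓜.measurable_φ i).const_inner

theorem abs_reward_le (hθ : θ ∈ 𝓜.params) (i : Fin m) (x : X) (y : Y) :
    |𝓜.reward θ i x y| ≤ 𝓜.B := by
  have h := (hθ i).2.1 x y
  exact abs_le.2 ⟨by have := h.1; have := 𝓜.one_le_B; unfold reward; linarith, h.2⟩

theorem abs_reward_sub_le (i : Fin m) (x : X) (y : Y) :
    |𝓜.reward θ i x y - 𝓜.reward θ' i x y| ≤ ‖θ i - θ' i‖ := by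
  rw [reward, reward, ← inner_sub_left]
  exact (abs_real_inner_le_norm _ _).trans
    (mul_le_of_le_one_right (norm_nonneg _) (𝓜.norm_φ_le i x y))

theorem θstar_mem_params : 𝓜.θstar ∈ 𝓜.params := 𝓜.θstar_mem

/-- The divergence terms cancel, so the bound is uniform over policies. -/
theorem abs_value_sub_le (hθ : θ ∈ 𝓜.params) (hθ' : θ' ∈ 𝓜.params) (π : 𝓜.Policy) (i : Fin m) :
    |𝓜.value θ π.toKernel i - 𝓜.value θ' π.toKernel i| ≤ ‖θ i - θ' i‖ := by
  have h := abs_expect_sub_expect_le (ρ := 𝓜.ρ) (π := π.toKernel) (𝓜.measurable_reward θ i)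
    (𝓜.measurable_reward θ' i) (𝓜.abs_reward_le hθ i) (𝓜.abs_reward_le hθ' i)
    (𝓜.abs_reward_sub_le i)
  simpa [value] using h

theorem value_le (hθ : θ ∈ 𝓜.params) (π : 𝓜.Policy) (i : Fin m) :
    𝓜.value θ π.toKernel i ≤ 𝓜.B - 𝓜.β * (expKL 𝓜.ρ π.toKernel 𝓜.πref).toReal := by
  have h := (abs_le.1 (abs_expect_le (ρ := 𝓜.ρ) (π := π.toKernel) (𝓜.abs_reward_le hθ i))).2
  simpa [value] using h

theorem value_le_B (hθ : θ ∈ 𝓜.params) (π : 𝓜.Policy) (i : Fin m) :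
    𝓜.value θ π.toKernel i ≤ 𝓜.B := by
  have h := 𝓜.value_le hθ π i
  have := mul_nonneg 𝓜.β_pos.le
    (ENNReal.toReal_nonneg (a := expKL 𝓜.ρ π.toKernel 𝓜.πref))
  linarith

theorem le_value (hθ : θ ∈ 𝓜.params) (π : 𝓜.Policy) (i : Fin m) :
    -(𝓜.β * (expKL 𝓜.ρ π.toKernel 𝓜.πref).toReal) ≤ 𝓜.value θ π.toKernel i := by
  have h : 0 ≤ expect 𝓜.ρ π.toKernel (𝓜.reward θ i) :=
    integral_nonneg fun x => integral_nonneg fun y => ((hθ i).2.1 x y).1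
  simpa [value] using h

variable {w : Fin m → ℝ}

theorem J_le (hw : w ∈ stdSimplex ℝ (Fin m)) {c : ℝ} {π : 𝓜.Policy}
    (h : ∀ i, 𝓜.value θ π.toKernel i ≤ c) : 𝓜.J θ w π ≤ c := by
  calc 𝓜.J θ w π ≤ ∑ i, w i * c :=
        Finset.sum_le_sum fun i _ => mul_le_mul_of_nonneg_left (h i) (hw.1 i)
    _ = c := by rw [← Finset.sum_mul, hw.2, one_mul]

theorem J_le_add (hw : w ∈ stdSimplex ℝ (Fin m)) (hθ : θ ∈ 𝓜.params) (hθ' : θ' ∈ 𝓜.params)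
    (π : 𝓜.Policy) : 𝓜.J θ w π ≤ 𝓜.J θ' w π + ∑ i, w i * ‖θ i - θ' i‖ := by
  rw [J, J, ← Finset.sum_add_distrib]
  refine Finset.sum_le_sum fun i _ => ?_
  rw [← mul_add]
  refine mul_le_mul_of_nonneg_left ?_ (hw.1 i)
  linarith [(abs_le.1 (𝓜.abs_value_sub_le hθ hθ' π i)).2]

theorem J_bddAbove (hw : w ∈ stdSimplex ℝ (Fin m)) (hθ : θ ∈ 𝓜.params) :
    BddAbove (Set.range fun π : 𝓜.Policy => 𝓜.J θ w π) :=
  ⟨𝓜.B, by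
    rintro _ ⟨π, rfl⟩
    exact 𝓜.J_le hw (𝓜.value_le_B hθ π)⟩

/-- The value vector of a greedy policy is bounded by `B`. -/
theorem abs_value_le_of_isMaxOn (hw : w ∈ stdSimplex ℝ (Fin m)) (hθ : θ ∈ 𝓜.params)
    {π : 𝓜.Policy} (hπ : IsMaxOn (𝓜.J θ w) Set.univ π) (i : Fin m) :
    |𝓜.value θ π.toKernel i| ≤ 𝓜.B := by
  -- The reference policy has nonnegative objective and the greedy one at most `B - β KL`. Hence `β
  -- KL ≤ B`, which bounds the values from below.
  let π₀ : 𝓜.Policy := ⟨𝓜.πref, 𝓜.isMarkov_ref, by simp [expKL_ref]⟩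
  have h1 : 𝓜.J θ w π₀ ≤ 𝓜.J θ w π := hπ (Set.mem_univ π₀)
  have h2 : 0 ≤ 𝓜.J θ w π₀ := Finset.sum_nonneg fun i _ => mul_nonneg (hw.1 i) <| by
    have h := 𝓜.le_value hθ π₀ i
    have h0 : expKL 𝓜.ρ π₀.toKernel 𝓜.πref = 0 := 𝓜.expKL_ref
    simpa [h0] using h
  have h3 := 𝓜.J_le hw (𝓜.value_le hθ π)
  have h4 := 𝓜.le_value hθ π i
  exact abs_le.2 ⟨by linarith, 𝓜.value_le_B hθ π i⟩

theorem measurable_log_partition {f : X → Y → ℝ} (hf : Measurable (Function.uncurry f)) :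
    Measurable fun x => Real.log (∫ y, Real.exp (f x y / 𝓜.β) ∂(𝓜.πref x)) :=
  (measurable_integral_section (f := fun x y => Real.exp (f x y / 𝓜.β))
    (hf.div_const 𝓜.β).exp).log

theorem measurable_logRatio {f : X → Y → ℝ} (hf : Measurable (Function.uncurry f)) :
    Measurable (Function.uncurry (𝓜.logRatio f)) :=
  (hf.div_const 𝓜.β).sub ((𝓜.measurable_log_partition hf).comp measurable_fst)

theorem abs_logRatio_sub_le {f g : X → Y → ℝ} (hf : Measurable (Function.uncurry f))
    (hg : Measurable (Function.uncurry g)) {C c : ℝ} (hfC : ∀ x y, |f x y| ≤ C)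
    (hgC : ∀ x y, |g x y| ≤ C) (h : ∀ x y, |f x y - g x y| ≤ c) (x : X) (y : Y) :
    |𝓜.logRatio f x y - 𝓜.logRatio g x y| ≤ 2 * (c / 𝓜.β) := by
  have hβ := 𝓜.β_pos
  have hdiv : ∀ {a b : ℝ}, |a| ≤ b → |a / 𝓜.β| ≤ b / 𝓜.β := fun h => by
    rw [abs_div, abs_of_pos hβ]
    gcongr
  have h1 := abs_log_integral_exp_sub_le (μ := 𝓜.πref x) (f := fun y => f x y / 𝓜.β)
    (g := fun y => g x y / 𝓜.β) (C := C / 𝓜.β) (c := c / 𝓜.β)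
    ((hf.comp measurable_prodMk_left).div_const _) ((hg.comp measurable_prodMk_left).div_const _)
    (fun y => hdiv (hfC x y)) (fun y => hdiv (hgC x y))
    (fun y => by rw [← sub_div]; exact hdiv (h x y))
  have h2 := hdiv (h x y)
  rw [sub_div] at h2
  rw [abs_le] at h1 h2 ⊢
  unfold logRatio
  constructor <;> linarith

theorem abs_logRatio_le {f : X → Y → ℝ} (hf : Measurable (Function.uncurry f)) {C : ℝ}
    (hfC : ∀ x y, |f x y| ≤ C) (x : X) (y : Y) : |𝓜.logRatio f x y| ≤ 2 * (C / 𝓜.β) := by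
  have hC : 0 ≤ C := (abs_nonneg _).trans (hfC x y)
  have h := 𝓜.abs_logRatio_sub_le (g := fun _ _ => 0) hf measurable_const hfC (fun _ _ => by simpa using hC)
    (by simpa using hfC) x y
  simpa [logRatio] using h

theorem abs_sum_mul_reward_le (hw : w ∈ stdSimplex ℝ (Fin m)) (hθ : θ ∈ 𝓜.params) (x : X) (y : Y) :
    |∑ i, w i * 𝓜.reward θ i x y| ≤ 𝓜.B := by
  refine (Finset.abs_sum_le_sum_abs _ _).trans ?_
  calc ∑ i, |w i * 𝓜.reward θ i x y| ≤ ∑ i, w i * 𝓜.B := Finset.sum_le_sum fun i _ => by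
        rw [abs_mul, abs_of_nonneg (hw.1 i)]
        exact mul_le_mul_of_nonneg_left (𝓜.abs_reward_le hθ i x y) (hw.1 i)
    _ = 𝓜.B := by rw [← Finset.sum_mul, hw.2, one_mul]

theorem abs_sum_mul_reward_sub_le (hw : w ∈ stdSimplex ℝ (Fin m)) (x : X) (y : Y) :
    |∑ i, w i * 𝓜.reward θ i x y - ∑ i, w i * 𝓜.reward θ' i x y| ≤
      ∑ i, w i * ‖θ i - θ' i‖ := by
  rw [← Finset.sum_sub_distrib]
  refine (Finset.abs_sum_le_sum_abs _ _).trans (Finset.sum_le_sum fun i _ => ?_)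
  rw [← mul_sub, abs_mul, abs_of_nonneg (hw.1 i)]
  exact mul_le_mul_of_nonneg_left (𝓜.abs_reward_sub_le i x y) (hw.1 i)

theorem measurable_sum_mul_reward (w : Fin m → ℝ) (θ : Fin m → EuclideanSpace ℝ (Fin d)) :
    Measurable (Function.uncurry fun x y => ∑ i, w i * 𝓜.reward θ i x y) :=
  Finset.measurable_fun_sum _ fun i _ => (𝓜.measurable_reward θ i).const_mul (w i)

/-- Both subroutines return parameters whose likelihood is, up to the size of the parameter error,
at least that of any competitor. -/
theorem sum_L_le_of_isMaxOn {M : ℕ} {D : Dataset X Y m M} {η : ℝ}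
    (hw : w ∈ stdSimplex ℝ (Fin m)) (hθ : θ ∈ 𝓜.params) (hθ' : θ' ∈ 𝓜.params)
    (h : IsMaxOn (𝓜.objRB D η w) 𝓜.params θ ∨ IsMaxOn (𝓜.objRF D η w) 𝓜.params θ) :
    η * ∑ i, 𝓜.L D θ i ≤ η * ∑ i, 𝓜.L D θ' i + 2 * ∑ i, w i * ‖θ i - θ' i‖ := by
  have h0 : 0 ≤ ∑ i, w i * ‖θ i - θ' i‖ :=
    Finset.sum_nonneg fun i _ => mul_nonneg (hw.1 i) (norm_nonneg _)
  rcases h with h | h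
  · have h1 : 𝓜.objRB D η w θ' ≤ 𝓜.objRB D η w θ := h hθ'
    -- A supremum of uniformly Lipschitz functions of the parameter is Lipschitz.
    have h2 : (⨆ π : 𝓜.Policy, 𝓜.J θ' w π) ≤
        (⨆ π : 𝓜.Policy, 𝓜.J θ w π) + ∑ i, w i * ‖θ i - θ' i‖ := ciSup_le fun π => by
      have e1 := 𝓜.J_le_add hw hθ' hθ π
      have e2 := le_ciSup (𝓜.J_bddAbove hw hθ) π
      simp only [norm_sub_rev (θ' _)] at e1
      linarith
    simp only [objRB, ← Finset.mul_sum] at h1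
    linarith
  · have h1 : 𝓜.objRF D η w θ' ≤ 𝓜.objRF D η w θ := h hθ'
    -- The partition function depends only on the prompt and cancels between winner and loser, so
    -- the reward-free likelihood is the Bradley–Terry one.
    have hlog : ∀ ϑ : Fin m → EuclideanSpace ℝ (Fin d),
        ∑ i, ∑ j, Real.log (Real.sigmoid
          (𝓜.β * 𝓜.logRatio (𝓜.reward ϑ i) (D i j).1 (D i j).2.1 -
            𝓜.β * 𝓜.logRatio (𝓜.reward ϑ i) (D i j).1 (D i j).2.2)) = -∑ i, 𝓜.L D ϑ i := by
      intro ϑ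
      have hβ := 𝓜.β_pos.ne'
      simp only [L, Finset.sum_neg_distrib, neg_neg]
      refine Finset.sum_congr rfl fun i _ => Finset.sum_congr rfl fun j _ => ?_
      congr 2
      simp only [logRatio]
      field_simp
      ring
    have hm := 𝓜.measurable_sum_mul_reward w
    -- The reward and the log-partition each move by the weighted parameter error over `β`; this is
    -- the factor 2, and `β` cancels.
    have h2 := abs_expect_sub_expect_le (ρ := 𝓜.ρ) (π := 𝓜.πbase)
      (𝓜.measurable_logRatio (hm θ)) (𝓜.measurable_logRatio (hm θ'))
      (𝓜.abs_logRatio_le (hm θ) (𝓜.abs_sum_mul_reward_le hw hθ))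
      (𝓜.abs_logRatio_le (hm θ') (𝓜.abs_sum_mul_reward_le hw hθ'))
      (𝓜.abs_logRatio_sub_le (hm θ) (hm θ') (𝓜.abs_sum_mul_reward_le hw hθ)
        (𝓜.abs_sum_mul_reward_le hw hθ') (𝓜.abs_sum_mul_reward_sub_le hw))
    have h3 := mul_le_mul_of_nonneg_left (abs_le.1 h2).2 𝓜.β_pos.le
    have h4 : 𝓜.β * (2 * ((∑ i, w i * ‖θ i - θ' i‖) / 𝓜.β)) = 2 * ∑ i, w i * ‖θ i - θ' i‖ := by
      have := 𝓜.β_pos.ne'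
      field_simp
    simp only [objRF, hlog] at h1
    linarith

end reward

/-! ### The returned policy -/

section mixture

variable (𝓜 : Model X Y m d N) {T : ℕ}

theorem expKL_mixture_le [MeasurableSpace.CountablyGenerated Y] (hT : 1 ≤ T) (π : ℕ → 𝓜.Policy) :
    expKL 𝓜.ρ (𝓜.mixture T π) 𝓜.πref ≤
      (T : ℝ≥0∞)⁻¹ * ∑ t ∈ Finset.Icc 1 T, expKL 𝓜.ρ (π t).toKernel 𝓜.πref := by
  have hm : ∀ t, Measurable fun x => InformationTheory.klDiv ((π t).toKernel x) (𝓜.πref x) :=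
    fun t => measurable_klDiv_kernel _ _
  unfold expKL
  rw [← lintegral_finsetSum _ fun t _ => hm t,
    ← lintegral_const_mul _ (Finset.measurable_fun_sum _ fun t _ => hm t)]
  refine lintegral_mono fun x => ?_
  have h := klDiv_average_le (Finset.nonempty_Icc.2 hT) (fun t => (π t).toKernel x) (𝓜.πref x)
  simpa [mixture] using h

theorem expKL_mixture_ne_top [MeasurableSpace.CountablyGenerated Y] (hT : 1 ≤ T)
    (π : ℕ → 𝓜.Policy) : expKL 𝓜.ρ (𝓜.mixture T π) 𝓜.πref ≠ ∞ := by
  refine ne_top_of_le_ne_top (ENNReal.mul_ne_top (ENNReal.inv_ne_top.2 ?_) ?_)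
    (𝓜.expKL_mixture_le hT π)
  · simp
    omega
  · exact ENNReal.sum_ne_top.2 fun t _ => (π t).finite_kl

theorem expect_mixture {f : X → Y → ℝ} (hf : Measurable (Function.uncurry f)) {c : ℝ}
    (hc : ∀ x y, |f x y| ≤ c) (π : ℕ → 𝓜.Policy) :
    expect 𝓜.ρ (𝓜.mixture T π) f =
      (T : ℝ)⁻¹ * ∑ t ∈ Finset.Icc 1 T, expect 𝓜.ρ (π t).toKernel f := by
  unfold expect
  rw [← integral_finsetSum _ fun t _ => integrable_integral_section hf hc, ← integral_const_mul]
  refine integral_congr_ae (ae_of_all _ fun x => ?_)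
  change ∫ y, f x y ∂((T : ℝ≥0∞)⁻¹ • ∑ t ∈ Finset.Icc 1 T, (π t).toKernel x) = _
  rw [integral_smul_measure, integral_finsetSum_measure fun t _ => integrable_section hf hc x]
  simp

/-- The value of the mixture dominates the average value. -/
theorem runAvg_value_le [MeasurableSpace.CountablyGenerated Y] (hT : 1 ≤ T) (π : ℕ → 𝓜.Policy)
    {θ : Fin m → EuclideanSpace ℝ (Fin d)} (hθ : θ ∈ 𝓜.params) (i : Fin m) :
    runAvg (fun t => 𝓜.value θ (π t).toKernel) T i ≤ 𝓜.value θ (𝓜.mixture T π) i := by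
  -- Expected rewards are linear in the policy; the divergence is convex and enters the value with a
  -- minus sign.
  have h1 : (expKL 𝓜.ρ (𝓜.mixture T π) 𝓜.πref).toReal ≤
      (T : ℝ)⁻¹ * ∑ t ∈ Finset.Icc 1 T, (expKL 𝓜.ρ (π t).toKernel 𝓜.πref).toReal := by
    have hfin : (T : ℝ≥0∞)⁻¹ * ∑ t ∈ Finset.Icc 1 T, expKL 𝓜.ρ (π t).toKernel 𝓜.πref ≠ ∞ := by
      refine ENNReal.mul_ne_top (ENNReal.inv_ne_top.2 ?_)
        (ENNReal.sum_ne_top.2 fun t _ => (π t).finite_kl)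
      simp
      omega
    refine (ENNReal.toReal_mono hfin (𝓜.expKL_mixture_le hT π)).trans_eq ?_
    rw [ENNReal.toReal_mul, ENNReal.toReal_sum fun t _ => (π t).finite_kl]
    simp
  have h2 := mul_le_mul_of_nonneg_left h1 𝓜.β_pos.le
  rw [runAvg, PiLp.smul_apply, WithLp.ofLp_sum, Finset.sum_apply, smul_eq_mul]
  simp only [value]
  rw [𝓜.expect_mixture (𝓜.measurable_reward θ i) (𝓜.abs_reward_le hθ i), Finset.sum_sub_distrib,
    ← Finset.mul_sum]
  linarith

end mixture

end Model

end MORLHF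

end

noncomputable section

namespace MORLHF

/-! ### Strong convexity of the logistic loss -/

/-- The product `σ(z) σ(-z)` is even, and for `z ≥ 0` its factors are at least `1 / 2` and `exp (-R)
/ 2`. -/
theorem exp_neg_div_four_le_sigmoid_mul {R z : ℝ} (hz : |z| ≤ R) :
    Real.exp (-R) / 4 ≤ Real.sigmoid z * (1 - Real.sigmoid z) := by
  have h : ∀ z : ℝ, 0 ≤ z → z ≤ R →
      Real.exp (-R) / 4 ≤ Real.sigmoid z * Real.sigmoid (-z) := fun z h0 hR => by
    have h1 : 1 / 2 ≤ Real.sigmoid z := by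
      have := Real.sigmoid_le h0
      rw [Real.sigmoid_zero] at this
      linarith
    have h2 : Real.exp (-R) / 2 ≤ Real.sigmoid (-z) := by
      rw [Real.sigmoid_def, neg_neg, Real.exp_neg, div_eq_mul_inv, ← mul_inv]
      have h3 := Real.exp_le_exp.2 hR
      have h4 := Real.one_le_exp (h0.trans hR)
      gcongr
      linarith
    have := Real.exp_pos (-R)
    nlinarith
  rw [← Real.sigmoid_neg]
  rcases le_total 0 z with h0 | h0
  · exact h z h0 ((le_abs_self z).trans hz)
  · have := h (-z) (by linarith) ((neg_le_abs z).trans hz)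
    rwa [neg_neg, mul_comm] at this

/-- The loss minus `κ / 2 * x ^ 2` has second derivative `σ (1 - σ) - κ ≥ 0` on `[-R, R]`, hence
lies above its tangent at `z₀`. -/
theorem neg_log_sigmoid_ge {R z z₀ : ℝ} (hz : |z| ≤ R) (hz₀ : |z₀| ≤ R) :
    -Real.log (Real.sigmoid z₀) - (1 - Real.sigmoid z₀) * (z - z₀) +
      Real.exp (-R) / 8 * (z - z₀) ^ 2 ≤ -Real.log (Real.sigmoid z) := by
  set κ := Real.exp (-R) / 4 with hκ
  let h : ℝ → ℝ := fun x => -Real.log (Real.sigmoid x) - κ / 2 * x ^ 2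
  have hd : ∀ x, HasDerivAt h (-(1 - Real.sigmoid x) - κ * x) x := fun x => by
    have h1 := ((Real.hasDerivAt_sigmoid x).log (Real.sigmoid_pos x).ne').neg
    have h2 := (hasDerivAt_pow 2 x).const_mul (κ / 2)
    refine (h1.sub h2).congr_deriv ?_
    have := (Real.sigmoid_pos x).ne'
    field_simp
    simp only [Nat.cast_ofNat, Nat.add_one_sub_one, pow_one]
    ring
  have hd2 : ∀ x, HasDerivAt (fun x => -(1 - Real.sigmoid x) - κ * x)
      (Real.sigmoid x * (1 - Real.sigmoid x) - κ) x := fun x => by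
    have h1 := ((Real.hasDerivAt_sigmoid x).const_sub 1).neg
    have h2 := (hasDerivAt_id x).const_mul κ
    refine (h1.sub h2).congr_deriv ?_
    ring
  have hconv : ConvexOn ℝ (Set.Icc (-R) R) h := by
    refine convexOn_of_hasDerivWithinAt2_nonneg (convex_Icc _ _)
      (fun x _ => (hd x).continuousAt.continuousWithinAt) (fun x _ => (hd x).hasDerivWithinAt)
      (fun x _ => (hd2 x).hasDerivWithinAt) fun x hx => ?_
    have hx' : x ∈ Set.Icc (-R) R := interior_subset hx
    have := exp_neg_div_four_le_sigmoid_mul (abs_le.2 hx')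
    linarith
  have htan : h z₀ + (-(1 - Real.sigmoid z₀) - κ * z₀) * (z - z₀) ≤ h z := by
    rcases lt_trichotomy z₀ z with hlt | rfl | hlt
    · have := hconv.le_slope_of_hasDerivAt (abs_le.1 hz₀) (abs_le.1 hz) hlt (hd z₀)
      rw [slope_def_field, le_div_iff₀ (by linarith)] at this
      linarith
    · simp
    · have := hconv.slope_le_of_hasDerivAt (abs_le.1 hz) (abs_le.1 hz₀) hlt (hd z₀)
      rw [slope_def_field, div_le_iff₀ (by linarith)] at this
      linarith
  simp only [h] at htan
  have e : Real.exp (-R) / 8 = κ / 2 := by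
    rw [hκ]
    ring
  rw [e]
  nlinarith

/-! ### The smallest eigenvalue -/

theorem lambdaMin_nonneg {d : ℕ} {A : Matrix (Fin d) (Fin d) ℝ} (hA : A.PosSemidef) :
    0 ≤ lambdaMin A :=
  Real.sInf_nonneg fun _ hx =>
    (Matrix.posSemidef_iff_isHermitian_and_spectrum_nonneg.1 hA).2 hx

/-- Subtracting `lambdaMin A` times the identity shifts the spectrum and leaves it nonnegative. -/
theorem lambdaMin_mul_le {d : ℕ} {A : Matrix (Fin d) (Fin d) ℝ} (hA : A.PosSemidef)
    (x : Fin d → ℝ) : lambdaMin A * (x ⬝ᵥ x) ≤ x ⬝ᵥ A.mulVec x := by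
  have hs := Matrix.posSemidef_iff_isHermitian_and_spectrum_nonneg.1 hA
  have h : (A - algebraMap ℝ _ (lambdaMin A)).PosSemidef := by
    refine Matrix.posSemidef_iff_isHermitian_and_spectrum_nonneg.2 ⟨hA.1.sub ?_, ?_⟩
    · rw [Matrix.algebraMap_eq_diagonal]
      exact Matrix.isHermitian_diagonal _
    · rw [← spectrum.sub_singleton_eq]
      rintro _ ⟨y, hy, z, hz, rfl⟩
      rw [Set.mem_singleton_iff] at hz
      subst hz
      exact sub_nonneg.2 (csInf_le ⟨0, fun y hy => hs.2 hy⟩ hy)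
  have h2 := h.dotProduct_mulVec_nonneg x
  rw [Matrix.sub_mulVec, dotProduct_sub, Algebra.algebraMap_eq_smul_one, Matrix.smul_mulVec,
    Matrix.one_mulVec, dotProduct_smul, star_trivial, smul_eq_mul] at h2
  linarith

/-! ### Error of the maximum likelihood estimates -/

namespace Model

variable {X Y : Type*} [MeasurableSpace X] [MeasurableSpace Y] {m d N M : ℕ}
  (𝓜 : Model X Y m d N)

/-- The feature difference of a triple. -/
def featDiff (i : Fin m) (a : X × Y × Y) : EuclideanSpace ℝ (Fin d) :=
  𝓜.φ i a.1 a.2.1 - 𝓜.φ i a.1 a.2.2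

theorem norm_featDiff_le (i : Fin m) (a : X × Y × Y) : ‖𝓜.featDiff i a‖ ≤ 2 := by
  refine (norm_sub_le _ _).trans ?_
  have := 𝓜.norm_φ_le i a.1 a.2.1
  have := 𝓜.norm_φ_le i a.1 a.2.2
  linarith

theorem reward_sub_reward (θ : Fin m → EuclideanSpace ℝ (Fin d)) (i : Fin m) (a : X × Y × Y) :
    𝓜.reward θ i a.1 a.2.1 - 𝓜.reward θ i a.1 a.2.2 = inner ℝ (θ i) (𝓜.featDiff i a) := by
  rw [reward, reward, featDiff, inner_sub_right]

/-- The negative gradient of the negative log-likelihood at the true parameter. -/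
def score (D : Dataset X Y m M) (i : Fin m) : EuclideanSpace ℝ (Fin d) :=
  ∑ j, (1 - Real.sigmoid (inner ℝ (𝓜.θstar i) (𝓜.featDiff i (D i j)))) • 𝓜.featDiff i (D i j)

theorem covMatrix_eq (D : Dataset X Y m M) (i : Fin m) :
    𝓜.covMatrix D i = (M : ℝ)⁻¹ • ∑ j, Matrix.vecMulVec (𝓜.featDiff i (D i j)).ofLp
      (star (𝓜.featDiff i (D i j)).ofLp) := rfl

theorem posSemidef_covMatrix (D : Dataset X Y m M) (i : Fin m) :
    (𝓜.covMatrix D i).PosSemidef := by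
  rw [covMatrix_eq]
  exact (Matrix.posSemidef_sum _ fun j _ => Matrix.posSemidef_vecMulVec_self_star _).smul
    (by positivity)

theorem lambdaMin_mul_norm_sq_le (hM : 1 ≤ M) (D : Dataset X Y m M) (i : Fin m)
    (v : EuclideanSpace ℝ (Fin d)) :
    M * lambdaMin (𝓜.covMatrix D i) * ‖v‖ ^ 2 ≤
      ∑ j, inner ℝ v (𝓜.featDiff i (D i j)) ^ 2 := by
  have hM' : (0 : ℝ) < M := by exact_mod_cast hM
  have h := lambdaMin_mul_le (𝓜.posSemidef_covMatrix D i) v.ofLp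
  have h1 : v.ofLp ⬝ᵥ v.ofLp = ‖v‖ ^ 2 := by
    rw [← real_inner_self_eq_norm_sq, EuclideanSpace.inner_eq_star_dotProduct, star_trivial]
  have h2 : v.ofLp ⬝ᵥ (𝓜.covMatrix D i).mulVec v.ofLp =
      (M : ℝ)⁻¹ * ∑ j, inner ℝ v (𝓜.featDiff i (D i j)) ^ 2 := by
    rw [covMatrix_eq, Matrix.smul_mulVec, dotProduct_smul, smul_eq_mul, Matrix.sum_mulVec,
      dotProduct_sum]
    congr 1
    refine Finset.sum_congr rfl fun j _ => ?_
    rw [EuclideanSpace.inner_eq_star_dotProduct, star_trivial, star_trivial,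
      Matrix.vecMulVec_mulVec, dotProduct_comm]
    rw [smul_dotProduct, op_smul_eq_mul, sq]
  rw [h1, h2] at h
  calc M * lambdaMin (𝓜.covMatrix D i) * ‖v‖ ^ 2 =
        M * (lambdaMin (𝓜.covMatrix D i) * ‖v‖ ^ 2) := by ring
    _ ≤ M * ((M : ℝ)⁻¹ * ∑ j, inner ℝ v (𝓜.featDiff i (D i j)) ^ 2) := by gcongr
    _ = _ := mul_inv_cancel_left₀ hM'.ne' _

/-- Strong convexity of the loss at each sample, summed. Feature differences have norm at most 2, so
margins stay within `2 * B'`; the linear part is the inner product with the score. -/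
theorem L_sub_L_ge (hM : 1 ≤ M) (D : Dataset X Y m M) {θ : Fin m → EuclideanSpace ℝ (Fin d)}
    (hθ : θ ∈ 𝓜.params) (i : Fin m) :
    -(‖𝓜.score D i‖ * ‖θ i - 𝓜.θstar i‖) + Real.exp (-(2 * 𝓜.B')) / 8 *
      (M * lambdaMin (𝓜.covMatrix D i) * ‖θ i - 𝓜.θstar i‖ ^ 2) ≤
      𝓜.L D θ i - 𝓜.L D 𝓜.θstar i := by
  have habs : ∀ θ ∈ 𝓜.params, ∀ j, |inner ℝ (θ i) (𝓜.featDiff i (D i j))| ≤ 2 * 𝓜.B' :=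
    fun θ hθ j => by
      refine (abs_real_inner_le_norm _ _).trans ?_
      have h1 := 𝓜.norm_le_B' i (θ i) (hθ i)
      have h2 := 𝓜.norm_featDiff_le i (D i j)
      nlinarith [norm_nonneg (θ i), norm_nonneg (𝓜.featDiff i (D i j))]
  have h1 : ∀ j, -((1 - Real.sigmoid (inner ℝ (𝓜.θstar i) (𝓜.featDiff i (D i j)))) *
        inner ℝ (θ i - 𝓜.θstar i) (𝓜.featDiff i (D i j))) +
      Real.exp (-(2 * 𝓜.B')) / 8 * inner ℝ (θ i - 𝓜.θstar i) (𝓜.featDiff i (D i j)) ^ 2 ≤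
      Real.log (Real.sigmoid (inner ℝ (𝓜.θstar i) (𝓜.featDiff i (D i j)))) -
        Real.log (Real.sigmoid (inner ℝ (θ i) (𝓜.featDiff i (D i j)))) := fun j => by
    have := neg_log_sigmoid_ge (habs θ hθ j) (habs _ 𝓜.θstar_mem_params j)
    rw [inner_sub_left]
    linarith
  have h2 := Finset.sum_le_sum fun j (_ : j ∈ Finset.univ) => h1 j
  have h3 : inner ℝ (θ i - 𝓜.θstar i) (𝓜.score D i) =
      ∑ j, (1 - Real.sigmoid (inner ℝ (𝓜.θstar i) (𝓜.featDiff i (D i j)))) *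
        inner ℝ (θ i - 𝓜.θstar i) (𝓜.featDiff i (D i j)) := by
    simp only [score, inner_sum, real_inner_smul_right]
  rw [Finset.sum_add_distrib, Finset.sum_neg_distrib, ← Finset.mul_sum, Finset.sum_sub_distrib,
    ← h3] at h2
  have h4 := real_inner_le_norm (θ i - 𝓜.θstar i) (𝓜.score D i)
  have h5 := mul_le_mul_of_nonneg_left (𝓜.lambdaMin_mul_norm_sq_le hM D i (θ i - 𝓜.θstar i))
    (by positivity : 0 ≤ Real.exp (-(2 * 𝓜.B')) / 8)
  simp only [L, reward_sub_reward]
  linarith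

/-- Parameters that nearly maximize the likelihood are close to the true ones. -/
theorem norm_sub_θstar_le (hM : 1 ≤ M) {D : Dataset X Y m M} {s : ℝ} (hs : 0 ≤ s)
    (hscore : ∀ i, ‖𝓜.score D i‖ ≤ s * √(M : ℝ)) {w : Fin m → ℝ} (hw : w ∈ stdSimplex ℝ (Fin m))
    {θ : Fin m → EuclideanSpace ℝ (Fin d)} (hθ : θ ∈ 𝓜.params)
    (h : 1 / √(M : ℝ) * ∑ i, 𝓜.L D θ i ≤ 1 / √(M : ℝ) * ∑ i, 𝓜.L D 𝓜.θstar i +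
      2 * ∑ i, w i * ‖θ i - 𝓜.θstar i‖) (i : Fin m) :
    ‖θ i - 𝓜.θstar i‖ ≤ 8 * (s + 2 + 𝓜.B') * √(m : ℝ) * Real.exp 𝓜.B' ^ 2 *
      ((⨅ i, lambdaMin (𝓜.covMatrix D i)) + 1 / (M : ℝ))⁻¹ / √(M : ℝ) := by
  have hM1 : (1 : ℝ) ≤ M := by exact_mod_cast hM
  have hM0 : (0 : ℝ) < M := by linarith
  set r := √(M : ℝ) with hr
  have hr1 : 1 ≤ r := Real.one_le_sqrt.2 hM1
  have hr0 : 0 < r := by linarith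
  have hrM : r * r = M := Real.mul_self_sqrt hM0.le
  set lam := (⨅ i, lambdaMin (𝓜.covMatrix D i)) + 1 / (M : ℝ) with hlam
  have hlam0 : 0 < lam := add_pos_of_nonneg_of_pos
    (Real.iInf_nonneg fun i => lambdaMin_nonneg (𝓜.posSemidef_covMatrix D i)) (by positivity)
  -- The extra `1 / M` in `lam` costs a curvature term `κ * y i ^ 2`. It is absorbed in the linear
  -- term, since `κ ≤ 1 / 8` and `y i ≤ 2 * B'`.
  have hlami : ∀ i, M * lam - 1 ≤ M * lambdaMin (𝓜.covMatrix D i) := fun i => by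
    have h1 : (⨅ i, lambdaMin (𝓜.covMatrix D i)) ≤ lambdaMin (𝓜.covMatrix D i) :=
      ciInf_le (Set.finite_range _).bddBelow i
    have h2 : M * lam - 1 = M * ⨅ i, lambdaMin (𝓜.covMatrix D i) := by
      rw [hlam]
      field_simp
      ring
    rw [h2]
    gcongr
  have hB' : 0 ≤ 𝓜.B' := (norm_nonneg _).trans (𝓜.norm_le_B' i _ (hθ i))
  let y : EuclideanSpace ℝ (Fin m) := WithLp.toLp 2 fun i => ‖θ i - 𝓜.θstar i‖
  have hy : ∀ i, y i = ‖θ i - 𝓜.θstar i‖ := fun i => rfl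
  have hy0 : ∀ i, 0 ≤ y i := fun i => norm_nonneg _
  have hyB : ∀ i, y i ≤ 2 * 𝓜.B' := fun i => by
    have h1 := 𝓜.norm_le_B' i _ (hθ i)
    have h2 := 𝓜.norm_le_B' i _ (𝓜.θstar_mem i)
    have := norm_sub_le (θ i) (𝓜.θstar i)
    rw [hy]
    linarith
  set κ := Real.exp (-(2 * 𝓜.B')) / 8 with hκ
  have hκ0 : 0 < κ := by positivity
  have hκ1 : κ ≤ 1 / 8 := by
    have : Real.exp (-(2 * 𝓜.B')) ≤ 1 := Real.exp_le_one_iff.2 (by linarith)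
    linarith
  have hsum : ∑ i, (𝓜.L D θ i - 𝓜.L D 𝓜.θstar i) ≤ 2 * r * ∑ i, y i := by
    have h1 : 2 * ∑ i, w i * y i ≤ 2 * ∑ i, y i := by
      gcongr with i
      have hwi : w i ≤ 1 := hw.2 ▸ Finset.single_le_sum (fun j _ => hw.1 j) (Finset.mem_univ i)
      exact mul_le_of_le_one_left (hy0 i) hwi
    have h2 : r * (1 / r * ∑ i, 𝓜.L D θ i) ≤ r * (1 / r * ∑ i, 𝓜.L D 𝓜.θstar i +
      2 * ∑ i, y i) := mul_le_mul_of_nonneg_left (h.trans (by linarith)) hr0.le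
    rw [mul_add, ← mul_assoc, ← mul_assoc, mul_one_div_cancel hr0.ne', one_mul, one_mul] at h2
    rw [Finset.sum_sub_distrib]
    linarith
  have hterm : ∀ i, κ * M * lam * y i ^ 2 - (s + 𝓜.B') * r * y i ≤
      𝓜.L D θ i - 𝓜.L D 𝓜.θstar i := fun i => by
    refine le_trans ?_ (𝓜.L_sub_L_ge hM D hθ i)
    rw [← hy, ← hκ]
    have h1 : ‖𝓜.score D i‖ * y i ≤ s * r * y i :=
      mul_le_mul_of_nonneg_right (hscore i) (hy0 i)
    have h2 : κ * ((M * lam - 1) * y i ^ 2) ≤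
        κ * (M * lambdaMin (𝓜.covMatrix D i) * y i ^ 2) := by
      gcongr
      exact hlami i
    have h3 : κ * y i ^ 2 ≤ 𝓜.B' * r * y i := by
      have e1 : κ * y i ≤ 𝓜.B' * r := by
        have := mul_le_mul hκ1 (hyB i) (hy0 i) (by norm_num)
        nlinarith
      have := mul_le_mul_of_nonneg_right e1 (hy0 i)
      linarith
    linarith
  -- Near-optimality controls only the sum of the losses, so the errors are bounded jointly;
  -- Cauchy–Schwarz costs `√m`.
  have hmain : κ * M * lam * ‖y‖ ^ 2 ≤ (s + 2 + 𝓜.B') * r * (√(m : ℝ) * ‖y‖) := by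
    have h1 := (Finset.sum_le_sum fun i (_ : i ∈ Finset.univ) => hterm i).trans hsum
    rw [Finset.sum_sub_distrib, ← Finset.mul_sum, ← Finset.mul_sum] at h1
    have h2 : ‖y‖ ^ 2 = ∑ i, y i ^ 2 := by
      rw [EuclideanSpace.norm_sq_eq]
      exact Finset.sum_congr rfl fun i _ => by rw [Real.norm_eq_abs, sq_abs]
    have h3 : (s + 2 + 𝓜.B') * r * ∑ i, y i ≤ (s + 2 + 𝓜.B') * r * (√(m : ℝ) * ‖y‖) := by
      gcongr
      exact sum_le_sqrt_mul_norm y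
    rw [h2]
    linarith
  have hE : Real.exp 𝓜.B' ^ 2 * κ = 1 / 8 := by
    rw [hκ, ← Real.exp_nat_mul, mul_div_assoc', ← Real.exp_add]
    simp
  have hyi : y i ≤ ‖y‖ := by
    have := PiLp.norm_apply_le y i
    exact (le_abs_self _).trans this
  rw [← hy]
  refine hyi.trans ?_
  rw [le_div_iff₀ hr0, ← div_eq_mul_inv, le_div_iff₀ hlam0]
  rcases (norm_nonneg y).eq_or_lt with hY | hY
  · rw [← hY, zero_mul, zero_mul]
    positivity
  have h1 : κ * (‖y‖ * r * lam) ≤ (s + 2 + 𝓜.B') * √(m : ℝ) := by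
    refine le_of_mul_le_mul_right (a := r * ‖y‖) ?_ (by positivity)
    calc κ * (‖y‖ * r * lam) * (r * ‖y‖) = κ * (r * r) * lam * ‖y‖ ^ 2 := by ring
      _ ≤ _ := by
        rw [hrM]
        linarith
  calc ‖y‖ * r * lam = 8 * (Real.exp 𝓜.B' ^ 2 * κ) * (‖y‖ * r * lam) := by rw [hE]; ring
    _ = 8 * Real.exp 𝓜.B' ^ 2 * (κ * (‖y‖ * r * lam)) := by ring
    _ ≤ 8 * Real.exp 𝓜.B' ^ 2 * ((s + 2 + 𝓜.B') * √(m : ℝ)) := by gcongr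
    _ = _ := by ring

end Model

end MORLHF

end

noncomputable section

namespace MORLHF

/-! ### A Chernoff bound for independent labels -/

/-- The probability of the label `b` when `true` has probability `p`. -/
def labelProb (p : ℝ) (b : Bool) : ℝ := if b then p else 1 - p

/-- The centered indicator of the label `true`. -/
def labelNoise (p : ℝ) (b : Bool) : ℝ := if b then 1 - p else -p

theorem labelProb_nonneg {p : ℝ} (h0 : 0 ≤ p) (h1 : p ≤ 1) (b : Bool) : 0 ≤ labelProb p b := by
  unfold labelProb
  split_ifs <;> linarith

/-- Symmetrization: convexity bounds `exp (-t * p)` by the moment generating function of an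
independent negated label. The product is `1 + 2 * p * (1 - p) * (cosh t - 1) ≤ cosh t`. -/
theorem labelMGF_le {p : ℝ} (h0 : 0 ≤ p) (h1 : p ≤ 1) (t : ℝ) :
    ∑ b, labelProb p b * Real.exp (t * labelNoise p b) ≤ Real.exp (t ^ 2 / 2) := by
  rw [Fintype.sum_bool]
  simp only [labelProb, labelNoise, if_true, Bool.false_eq_true, if_false]
  have e1 : Real.exp (t * (1 - p)) = Real.exp t * Real.exp (t * -p) := by
    rw [← Real.exp_add]
    congr 1
    ring
  have e2 : Real.exp (t * -p) ≤ p * Real.exp (-t) + (1 - p) := by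
    have := convexOn_exp.2 (Set.mem_univ (-t)) (Set.mem_univ (0 : ℝ)) h0
      (by linarith : 0 ≤ 1 - p) (by ring)
    simp only [smul_eq_mul, mul_zero, add_zero, Real.exp_zero, mul_one] at this
    rwa [show t * -p = p * -t by ring]
  have e3 : Real.exp t * Real.exp (-t) = 1 := by rw [← Real.exp_add]; simp
  have e4 := Real.cosh_le_exp_half_sq t
  have e5 := Real.one_le_cosh t
  have e6 : Real.exp t + Real.exp (-t) = 2 * Real.cosh t := by rw [Real.cosh_eq]; ring
  have e7 : 0 ≤ p * Real.exp t + (1 - p) := by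
    have := mul_nonneg h0 (Real.exp_pos t).le
    linarith
  calc p * Real.exp (t * (1 - p)) + (1 - p) * Real.exp (t * -p) =
        (p * Real.exp t + (1 - p)) * Real.exp (t * -p) := by rw [e1]; ring
    _ ≤ (p * Real.exp t + (1 - p)) * (p * Real.exp (-t) + (1 - p)) :=
        mul_le_mul_of_nonneg_left e2 e7
    _ = p ^ 2 * (Real.exp t * Real.exp (-t)) + p * (1 - p) * (Real.exp t + Real.exp (-t)) +
        (1 - p) ^ 2 := by ring
    _ = 1 + 2 * (p * (1 - p)) * (Real.cosh t - 1) := by rw [e3, e6]; ring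
    _ ≤ 1 + 1 * (Real.cosh t - 1) := by
        have : 2 * (p * (1 - p)) ≤ 1 := by nlinarith [sq_nonneg (p - 1 / 2)]
        gcongr
    _ ≤ Real.exp (t ^ 2 / 2) := by linarith

theorem sum_prod_labelProb_exp_le {M : ℕ} {p a : Fin M → ℝ} (h0 : ∀ j, 0 ≤ p j)
    (h1 : ∀ j, p j ≤ 1) {c : ℝ} (ha : ∀ j, |a j| ≤ c) (t : ℝ) :
    ∑ s : Fin M → Bool, (∏ j, labelProb (p j) (s j)) *
      Real.exp (t * ∑ j, a j * labelNoise (p j) (s j)) ≤ Real.exp (M * (t * c) ^ 2 / 2) := by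
  have e1 : ∀ s : Fin M → Bool, (∏ j, labelProb (p j) (s j)) *
      Real.exp (t * ∑ j, a j * labelNoise (p j) (s j)) =
      ∏ j, labelProb (p j) (s j) * Real.exp (t * a j * labelNoise (p j) (s j)) := fun s => by
    rw [Finset.prod_mul_distrib, ← Real.exp_sum, Finset.mul_sum]
    simp only [mul_assoc]
  have e2 : ∑ s : Fin M → Bool,
      ∏ j, labelProb (p j) (s j) * Real.exp (t * a j * labelNoise (p j) (s j)) =
      ∏ j, ∑ b, labelProb (p j) b * Real.exp (t * a j * labelNoise (p j) b) := by
    rw [Finset.prod_univ_sum, Fintype.piFinset_univ]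
  simp only [e1]
  rw [e2]
  calc ∏ j, ∑ b, labelProb (p j) b * Real.exp (t * a j * labelNoise (p j) b)
      ≤ ∏ _j : Fin M, Real.exp ((t * c) ^ 2 / 2) := by
        refine Finset.prod_le_prod (fun j _ => Finset.sum_nonneg fun b _ =>
          mul_nonneg (labelProb_nonneg (h0 j) (h1 j) b) (Real.exp_pos _).le) fun j _ => ?_
        refine (labelMGF_le (h0 j) (h1 j) (t * a j)).trans (Real.exp_le_exp.2 ?_)
        have : a j ^ 2 ≤ c ^ 2 := sq_le_sq' (abs_le.1 (ha j)).1 (abs_le.1 (ha j)).2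
        rw [mul_pow, mul_pow]
        gcongr
    _ = Real.exp (M * (t * c) ^ 2 / 2) := by
        rw [Finset.prod_const, Finset.card_univ, Fintype.card_fin, ← Real.exp_nat_mul]
        congr 1
        ring

theorem sum_prod_labelProb_tail_le {M : ℕ} {p a : Fin M → ℝ} (h0 : ∀ j, 0 ≤ p j)
    (h1 : ∀ j, p j ≤ 1) {c : ℝ} (ha : ∀ j, |a j| ≤ c) {t : ℝ} (ht : 0 ≤ t) (u : ℝ) :
    ∑ s : Fin M → Bool, (if u ≤ ∑ j, a j * labelNoise (p j) (s j) then
      ∏ j, labelProb (p j) (s j) else 0) ≤ Real.exp (M * (t * c) ^ 2 / 2 - t * u) := by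
  have h := mul_le_mul_of_nonneg_right (sum_prod_labelProb_exp_le h0 h1 ha t)
    (Real.exp_pos (-(t * u))).le
  rw [← Real.exp_add, ← sub_eq_add_neg, Finset.sum_mul] at h
  refine (Finset.sum_le_sum fun s _ => ?_).trans h
  have hp : 0 ≤ ∏ j, labelProb (p j) (s j) :=
    Finset.prod_nonneg fun j _ => labelProb_nonneg (h0 j) (h1 j) _
  rw [mul_assoc, ← Real.exp_add]
  split_ifs with hu
  · refine le_mul_of_one_le_right hp (Real.one_le_exp ?_)
    have := mul_le_mul_of_nonneg_left hu ht
    linarith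
  · exact mul_nonneg hp (Real.exp_pos _).le

namespace Model

section concentration

variable {X Y Ω : Type*} [MeasurableSpace X] [MeasurableSpace Y] [MeasurableSpace Ω]
  {P : Measure Ω} {M : ℕ} {r : X → Y → ℝ}
  {A : Fin M → Ω → X × Y × Y} {b : Fin M → Ω → Bool}

/-- The probability that the first response is preferred. -/
def prefProb {X Y : Type*} (r : X → Y → ℝ) (a : X × Y × Y) : ℝ :=
  Real.sigmoid (r a.1 a.2.1 - r a.1 a.2.2)

theorem btProb_eq {X Y : Type*} (r : X → Y → ℝ) (a : X × Y × Y) (s : Bool) :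
    btProb r a s = labelProb (prefProb r a) s := by
  cases s
  · simp [btProb, labelProb, prefProb, ranked, ← Real.sigmoid_neg]
  · simp [btProb, labelProb, prefProb, ranked]

theorem measurable_prefProb (hr : Measurable (Function.uncurry r)) :
    Measurable (prefProb r) := by
  have h1 : Measurable fun a : X × Y × Y => r a.1 a.2.1 :=
    hr.comp (measurable_fst.prodMk (measurable_fst.comp measurable_snd))
  have h2 : Measurable fun a : X × Y × Y => r a.1 a.2.2 :=
    hr.comp (measurable_fst.prodMk (measurable_snd.comp measurable_snd))
  exact continuous_sigmoid.measurable.comp (h1.sub h2)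

theorem measurable_labelProb_prefProb (hr : Measurable (Function.uncurry r)) (s : Bool) :
    Measurable fun a => labelProb (prefProb r a) s := by
  have := measurable_prefProb hr
  cases s
  · simpa [labelProb] using this.const_sub 1
  · simpa [labelProb] using this

theorem measurable_labelNoise_prefProb (hr : Measurable (Function.uncurry r)) (s : Bool) :
    Measurable fun a => labelNoise (prefProb r a) s := by
  have := measurable_prefProb hr
  cases s
  · exact this.neg
  · simpa [labelNoise] using this.const_sub 1

theorem measurable_noise (hD : IsBTData P r A b) (hr : Measurable (Function.uncurry r))
    {ψ : X × Y × Y → ℝ} (hψ : Measurable ψ) :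
    Measurable fun ω => ∑ j, ψ (A j ω) * labelNoise (prefProb r (A j ω)) (b j ω) := by
  refine Finset.measurable_fun_sum _ fun j _ => (hψ.comp (hD.measurable_A j)).mul ?_
  have h : Measurable fun z : (X × Y × Y) × Bool => labelNoise (prefProb r z.1) z.2 :=
    measurable_from_prod_countable_left fun s => measurable_labelNoise_prefProb hr s
  exact h.comp ((hD.measurable_A j).prodMk (hD.measurable_b j))

/-- Conditionally on the prompts and responses, weighted sums of centered labels are
sub-Gaussian. -/
theorem measure_noise_ge_le [IsProbabilityMeasure P] (hD : IsBTData P r A b) (hr : Measurable (Function.uncurry r))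
    {ψ : X × Y × Y → ℝ} (hψ : Measurable ψ) {c : ℝ} (hc : ∀ a, |ψ a| ≤ c) {t : ℝ} (ht : 0 ≤ t)
    (u : ℝ) :
    P {ω | u ≤ ∑ j, ψ (A j ω) * labelNoise (prefProb r (A j ω)) (b j ω)} ≤
      ENNReal.ofReal (Real.exp (M * (t * c) ^ 2 / 2 - t * u)) := by
  -- For a fixed label vector the tail event concerns only the prompts and responses, so the assumed
  -- law gives its probability. The finitely many label vectors are then summed inside the integral.
  let E : (Fin M → Bool) → Set (Fin M → X × Y × Y) := fun s =>
    {a | u ≤ ∑ j, ψ (a j) * labelNoise (prefProb r (a j)) (s j)}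
  have hE : ∀ s, MeasurableSet (E s) := fun s => by
    refine measurableSet_le measurable_const (Finset.measurable_fun_sum _ fun j _ => ?_)
    exact (hψ.comp (measurable_pi_apply j)).mul
      ((measurable_labelNoise_prefProb hr (s j)).comp (measurable_pi_apply j))
  have hA : Measurable fun ω j => A j ω := measurable_pi_lambda _ hD.measurable_A
  have hcover : {ω | u ≤ ∑ j, ψ (A j ω) * labelNoise (prefProb r (A j ω)) (b j ω)} ⊆
      ⋃ s, {ω | (fun j => A j ω) ∈ E s ∧ ∀ j, b j ω = s j} := fun ω hω =>
    Set.mem_iUnion.2 ⟨fun j => b j ω, hω, fun _ => rfl⟩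
  have hpm : ∀ s : Fin M → Bool, Measurable fun ω =>
      ∏ j, ENNReal.ofReal (btProb r (A j ω) (s j)) := fun s => by
    refine Finset.measurable_fun_prod _ fun j _ => ENNReal.measurable_ofReal.comp ?_
    simp only [btProb_eq]
    exact (measurable_labelProb_prefProb hr (s j)).comp (hD.measurable_A j)
  have hEm : ∀ s, MeasurableSet {ω | (fun j => A j ω) ∈ E s} := fun s => hA (hE s)
  have hp0 : ∀ a, 0 ≤ prefProb r a := fun a => Real.sigmoid_nonneg _
  have hp1 : ∀ a, prefProb r a ≤ 1 := fun a => Real.sigmoid_le_one _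
  calc P {ω | u ≤ ∑ j, ψ (A j ω) * labelNoise (prefProb r (A j ω)) (b j ω)}
      ≤ ∑ s, P {ω | (fun j => A j ω) ∈ E s ∧ ∀ j, b j ω = s j} :=
        (measure_mono hcover).trans (measure_iUnion_fintype_le _ _)
    _ = ∑ s, ∫⁻ ω, {ω | (fun j => A j ω) ∈ E s}.indicator
          (fun ω => ∏ j, ENNReal.ofReal (btProb r (A j ω) (s j))) ω ∂P := by
        refine Finset.sum_congr rfl fun s _ => ?_
        rw [hD.law _ s (hE s), lintegral_indicator (hEm s)]
    _ = ∫⁻ ω, ∑ s, {ω | (fun j => A j ω) ∈ E s}.indicator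
          (fun ω => ∏ j, ENNReal.ofReal (btProb r (A j ω) (s j))) ω ∂P :=
        (lintegral_finsetSum _ fun s _ => (hpm s).indicator (hEm s)).symm
    _ ≤ ∫⁻ _ω, ENNReal.ofReal (Real.exp (M * (t * c) ^ 2 / 2 - t * u)) ∂P := by
        refine lintegral_mono fun ω => ?_
        refine le_trans (le_of_eq ?_) (ENNReal.ofReal_le_ofReal (sum_prod_labelProb_tail_le
          (fun j => hp0 (A j ω)) (fun j => hp1 (A j ω)) (fun j => hc (A j ω)) ht u))
        rw [ENNReal.ofReal_sum_of_nonneg]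
        · refine Finset.sum_congr rfl fun s _ => ?_
          have hmem : ω ∈ {ω | (fun j => A j ω) ∈ E s} ↔
              u ≤ ∑ j, ψ (A j ω) * labelNoise (prefProb r (A j ω)) (s j) := Iff.rfl
          by_cases h : u ≤ ∑ j, ψ (A j ω) * labelNoise (prefProb r (A j ω)) (s j)
          · rw [Set.indicator_of_mem (hmem.2 h), if_pos h, ENNReal.ofReal_prod_of_nonneg
              fun j _ => labelProb_nonneg (hp0 _) (hp1 _) _]
            simp only [btProb_eq]
          · rw [Set.indicator_of_notMem (fun h' => h (hmem.1 h')), if_neg h, ENNReal.ofReal_zero]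
        · intro s _
          split_ifs
          · exact Finset.prod_nonneg fun j _ => labelProb_nonneg (hp0 _) (hp1 _) _
          · exact le_rfl
    _ = _ := by rw [lintegral_const, measure_univ, mul_one]

theorem measure_abs_noise_ge_le [IsProbabilityMeasure P] (hD : IsBTData P r A b) (hr : Measurable (Function.uncurry r))
    {ψ : X × Y × Y → ℝ} (hψ : Measurable ψ) {c : ℝ} (hc : ∀ a, |ψ a| ≤ c) {t : ℝ} (ht : 0 ≤ t)
    (u : ℝ) :
    P {ω | u ≤ |∑ j, ψ (A j ω) * labelNoise (prefProb r (A j ω)) (b j ω)|} ≤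
      2 * ENNReal.ofReal (Real.exp (M * (t * c) ^ 2 / 2 - t * u)) := by
  have h1 := measure_noise_ge_le hD hr hψ hc ht u
  have h2 := measure_noise_ge_le hD hr hψ.neg (fun a => (abs_neg (ψ a)).trans_le (hc a)) ht u
  refine (measure_mono fun ω hω => ?_).trans
    ((measure_union_le _ _).trans ((add_le_add h1 h2).trans_eq (two_mul _).symm))
  rcases le_abs.1 (show u ≤ |_| from hω) with h | h
  · exact Or.inl h
  · refine Or.inr ?_
    change u ≤ ∑ j, (-ψ) (A j ω) * _
    simpa [Finset.sum_neg_distrib] using h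

end concentration

/-! ### Concentration of the score -/

section score

variable {X Y Ω : Type*} [MeasurableSpace X] [MeasurableSpace Y] [MeasurableSpace Ω]
  {P : Measure Ω} [IsProbabilityMeasure P] {m d N M : ℕ} (𝓜 : Model X Y m d N)
  {A : Fin m → Fin M → Ω → X × Y × Y} {b : Fin m → Fin M → Ω → Bool}

theorem measurable_featDiff_apply (i : Fin m) (k : Fin d) :
    Measurable fun a => 𝓜.featDiff i a k := by
  have h : Measurable fun z => Function.uncurry (𝓜.φ i) z k :=
    (EuclideanSpace.proj (𝕜 := ℝ) k).continuous.measurable.comp (𝓜.measurable_φ i)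
  have h1 : Measurable fun a : X × Y × Y => 𝓜.φ i a.1 a.2.1 k :=
    h.comp (measurable_fst.prodMk (measurable_fst.comp measurable_snd))
  have h2 : Measurable fun a : X × Y × Y => 𝓜.φ i a.1 a.2.2 k :=
    h.comp (measurable_fst.prodMk (measurable_snd.comp measurable_snd))
  exact h1.sub h2

theorem abs_featDiff_apply_le (i : Fin m) (k : Fin d) (a : X × Y × Y) :
    |𝓜.featDiff i a k| ≤ 2 :=
  (PiLp.norm_apply_le (𝓜.featDiff i a) k).trans (𝓜.norm_featDiff_le i a)

/-- Swapping the responses negates the feature difference, and `1 - σ(-z) = σ(z)`. The score thus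
becomes a sum of centered labels with weights independent of the labels. -/
theorem smul_featDiff_ranked (i : Fin m) (a : X × Y × Y) (s : Bool) :
    (1 - Real.sigmoid (inner ℝ (𝓜.θstar i) (𝓜.featDiff i (ranked a s)))) •
      𝓜.featDiff i (ranked a s) =
      labelNoise (prefProb (𝓜.reward 𝓜.θstar i) a) s • 𝓜.featDiff i a := by
  rw [prefProb, reward_sub_reward]
  cases s
  · have h : 𝓜.featDiff i (ranked a false) = -𝓜.featDiff i a := by
      simp [featDiff, ranked]
    rw [h, inner_neg_right, Real.sigmoid_neg]
    simp [labelNoise]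
  · simp [labelNoise, ranked]

theorem score_apply {Ω : Type*} {A : Fin m → Fin M → Ω → X × Y × Y}
    {b : Fin m → Fin M → Ω → Bool} {D : Dataset X Y m M} {ω : Ω}
    (hD : ∀ i j, D i j = ranked (A i j ω) (b i j ω)) (i : Fin m) (k : Fin d) :
    𝓜.score D i k = ∑ j, 𝓜.featDiff i (A i j ω) k *
      labelNoise (prefProb (𝓜.reward 𝓜.θstar i) (A i j ω)) (b i j ω) := by
  rw [score, WithLp.ofLp_sum, Finset.sum_apply]
  refine Finset.sum_congr rfl fun j _ => ?_
  rw [hD, smul_featDiff_ranked, PiLp.smul_apply, smul_eq_mul, mul_comm]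

/-- With high probability the score vectors at the true parameters are small. -/
theorem exists_score_event (hm : 1 ≤ m) (hd : 1 ≤ d) (hM : 1 ≤ M)
    (hD : ∀ i, IsBTData P (𝓜.reward 𝓜.θstar i) (A i) (b i)) {δ : ℝ} (hδ : 0 < δ) (hδ1 : δ < 1) :
    ∃ G : Set Ω, MeasurableSet G ∧ ENNReal.ofReal (1 - δ) ≤ P G ∧
      ∀ ω ∈ G, ∀ D : Dataset X Y m M, (∀ i j, D i j = ranked (A i j ω) (b i j ω)) →
        ∀ i, ‖𝓜.score D i‖ ≤ √(d : ℝ) * √(8 * Real.log (2 * (m * d / δ))) * √(M : ℝ) := by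
  have hm0 : (0 : ℝ) < m := by exact_mod_cast hm
  have hd0 : (0 : ℝ) < d := by exact_mod_cast hd
  have hM0 : (0 : ℝ) < M := by exact_mod_cast hM
  have hmd : 1 ≤ (m : ℝ) * d := by exact_mod_cast Nat.mul_le_mul hm hd
  have hx1 : 1 ≤ m * d / δ := by
    rw [le_div_iff₀ hδ]
    linarith
  set ℓ := Real.log (2 * (m * d / δ)) with hℓ
  have hℓ0 : 0 ≤ ℓ := Real.log_nonneg (by linarith)
  set u := √(8 * ℓ) * √(M : ℝ) with hu
  have hu0 : 0 ≤ u := by positivity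
  have hu2 : u ^ 2 = 8 * ℓ * M := by
    rw [hu, mul_pow, Real.sq_sqrt (by positivity), Real.sq_sqrt hM0.le]
  let S : Fin m → Fin d → Ω → ℝ := fun i k ω => ∑ j, 𝓜.featDiff i (A i j ω) k *
    labelNoise (prefProb (𝓜.reward 𝓜.θstar i) (A i j ω)) (b i j ω)
  have hS : ∀ i k, Measurable (S i k) := fun i k =>
    measurable_noise (hD i) (𝓜.measurable_reward _ i) (𝓜.measurable_featDiff_apply i k)
  -- A union bound over the `m * d` coordinates. The exponent `2 * M * t ^ 2 - t * u` is minimal at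
  -- `t = u / (4 * M)`, with value `-ℓ`.
  let Z : Set Ω := ⋃ z : Fin m × Fin d, {ω | u ≤ |S z.1 z.2 ω|}
  have hZ : MeasurableSet Z := MeasurableSet.iUnion fun z =>
    measurableSet_le measurable_const (hS z.1 z.2).abs
  have hPZ : P Z ≤ ENNReal.ofReal δ := by
    have hz : ∀ z : Fin m × Fin d,
        P {ω | u ≤ |S z.1 z.2 ω|} ≤ ENNReal.ofReal (δ / (m * d)) := fun z => by
      refine (measure_abs_noise_ge_le (hD z.1) (𝓜.measurable_reward _ z.1)
        (𝓜.measurable_featDiff_apply z.1 z.2) (𝓜.abs_featDiff_apply_le z.1 z.2)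
        (t := u / (4 * M)) (by positivity) u).trans_eq ?_
      have e1 : M * (u / (4 * M) * 2) ^ 2 / 2 - u / (4 * M) * u = -ℓ := by
        have : M * (u / (4 * M) * 2) ^ 2 / 2 - u / (4 * M) * u = -(u ^ 2 / (8 * M)) := by
          field_simp
          ring
        rw [this, hu2]
        field_simp
      rw [e1, Real.exp_neg, hℓ, Real.exp_log (by positivity),
        show (2 : ℝ≥0∞) = ENNReal.ofReal 2 by simp, ← ENNReal.ofReal_mul (by norm_num)]
      congr 1
      field_simp
    calc P Z ≤ ∑ z : Fin m × Fin d, P {ω | u ≤ |S z.1 z.2 ω|} := measure_iUnion_fintype_le _ _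
      _ ≤ ∑ _z : Fin m × Fin d, ENNReal.ofReal (δ / (m * d)) := Finset.sum_le_sum fun z _ => hz z
      _ = ENNReal.ofReal δ := by
        rw [Finset.sum_const, Finset.card_univ, Fintype.card_prod, Fintype.card_fin,
          Fintype.card_fin, nsmul_eq_mul, ← ENNReal.ofReal_natCast,
          ← ENNReal.ofReal_mul (Nat.cast_nonneg _)]
        congr 1
        push_cast
        field_simp
  refine ⟨Zᶜ, hZ.compl, ?_, fun ω hω D hDω i => ?_⟩
  · rw [prob_compl_eq_one_sub hZ, ENNReal.ofReal_sub _ hδ.le, ENNReal.ofReal_one]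
    exact tsub_le_tsub_left hPZ 1
  · rw [mul_assoc, ← hu]
    refine norm_le_sqrt_mul hu0 fun k => ?_
    rw [𝓜.score_apply hDω i k]
    by_contra! h
    exact hω (Set.mem_iUnion.2 ⟨(i, k), h.le⟩)

end score

end Model

end MORLHF

end

noncomputable section

/-! ### Assembling the regret bound -/

namespace MORLHF

namespace Model

section run

variable {X Y : Type*} [MeasurableSpace X] [MeasurableSpace Y] {m d N M q T : ℕ}
  (𝓜 : Model X Y m d N) {D : Dataset X Y m M} {w : ℕ → Fin m → ℝ}
  {θ : ℕ → Fin m → EuclideanSpace ℝ (Fin d)} {π : ℕ → 𝓜.Policy}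

theorem isUpperTarget_W (hm : 1 ≤ m) (n : Fin N) : IsUpperTarget (𝓜.W n) :=
  isUpperTarget_targetSet hm (𝓜.α_mem n) (𝓜.p_le_one n) _

/-- The greedy policy of round `t` is nearly as good as any policy in the direction of the
round. -/
theorem sum_mul_value_sub_S_ge (h : 𝓜.IsRun D q T w θ π) {t : ℕ} (ht : t ∈ Finset.Icc 1 T) {ε : ℝ}
    (hε : ∀ i, ‖θ t i - 𝓜.θstar i‖ ≤ ε) (πstar : 𝓜.Policy) :
    -ε ≤ ∑ i, w t i * (𝓜.value (θ t) (π t).toKernel i - 𝓜.S πstar.toKernel i) := by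
  have hw := h.dir_mem t ht
  have h1 : 𝓜.J (θ t) (w t) πstar ≤ 𝓜.J (θ t) (w t) (π t) := h.greedy t ht (Set.mem_univ _)
  -- Only the comparator passes from true to estimated rewards; the greedy policy is measured by its
  -- estimated value.
  have h2 := 𝓜.J_le_add hw 𝓜.θstar_mem_params (h.est_mem t ht) πstar
  have h3 : ∑ i, w t i * ‖𝓜.θstar i - θ t i‖ ≤ ε := by
    calc ∑ i, w t i * ‖𝓜.θstar i - θ t i‖ ≤ ∑ i, w t i * ε :=
          Finset.sum_le_sum fun i _ => mul_le_mul_of_nonneg_left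
            (by rw [norm_sub_rev]; exact hε i) (hw.1 i)
      _ = ε := by rw [← Finset.sum_mul, hw.2, one_mul]
  have h4 : ∑ i, w t i * (𝓜.value (θ t) (π t).toKernel i - 𝓜.S πstar.toKernel i) =
      𝓜.J (θ t) (w t) (π t) - 𝓜.J 𝓜.θstar (w t) πstar := by
    simp only [J, S, mul_sub, Finset.sum_sub_distrib]
  rw [h4]
  linarith

/-- A nonzero direction is its `ℓ¹` norm, at most `√m`, times the simplex vector used in the next
round. A zero direction contributes nothing, whatever vector is chosen. -/
theorem inner_malfareDir_ge (hm : 1 ≤ m) (hq : 1 ≤ q) (h : 𝓜.IsRun D q T w θ π) {ε : ℝ}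
    (hε0 : 0 ≤ ε) (hε : ∀ t ∈ Finset.Icc 1 T, ∀ i, ‖θ t i - 𝓜.θstar i‖ ≤ ε) (πstar : 𝓜.Policy)
    {t : ℕ} (ht : 1 ≤ t) (htT : t + 1 ≤ T) :
    -(√(m : ℝ) * ε) ≤ inner ℝ (malfareDir q 𝓜.ζ 𝓜.W (𝓜.avgV θ π t))
      (𝓜.value (θ (t + 1)) (π (t + 1)).toKernel - 𝓜.S πstar.toKernel) := by
  have hζ : ∀ n, 0 ≤ 𝓜.ζ n := fun n => (𝓜.ζ_pos n).le
  have hmem : t + 1 ∈ Finset.Icc 1 T := Finset.mem_Icc.2 ⟨by omega, htT⟩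
  have hdir := h.dir_eq t ht htT
  have hnn := malfareDir_nonneg hq hζ (𝓜.isUpperTarget_W hm) (𝓜.avgV θ π t)
  have hnorm := norm_malfareDir_le (W := 𝓜.W) hq hζ 𝓜.ζ_sum (𝓜.avgV θ π t)
  have hval := 𝓜.sum_mul_value_sub_S_ge h hmem (hε _ hmem) πstar
  set v := malfareDir q 𝓜.ζ 𝓜.W (𝓜.avgV θ π t) with hv
  set z := 𝓜.value (θ (t + 1)) (π (t + 1)).toKernel - 𝓜.S πstar.toKernel with hz
  have hs : 0 ≤ √(m : ℝ) * ε := by positivity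
  by_cases h0 : v = 0
  · rw [h0, inner_zero_left]
    linarith
  have habs : ∑ k, |v k| = ∑ k, v k := Finset.sum_congr rfl fun k _ => abs_of_nonneg (hnn k)
  have hsum0 : 0 ≤ ∑ k, v k := Finset.sum_nonneg fun k _ => hnn k
  have hsum : ∑ k, v k ≠ 0 := fun h' => h0 <| by
    ext k
    exact (Finset.sum_eq_zero_iff_of_nonneg fun k _ => hnn k).1 h' k (Finset.mem_univ k)
  have hle : ∑ k, v k ≤ √(m : ℝ) := (sum_le_sqrt_mul_norm v).trans
    (mul_le_of_le_one_right (Real.sqrt_nonneg _) hnorm)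
  have hinner : inner ℝ v z = (∑ k, v k) * ∑ i, w (t + 1) i * z i := by
    rw [PiLp.inner_apply, Finset.mul_sum]
    refine Finset.sum_congr rfl fun i _ => ?_
    rw [hdir h0 i, habs]
    simp only [RCLike.inner_apply, conj_trivial]
    field_simp
  rw [hinner]
  calc -(√(m : ℝ) * ε) ≤ -((∑ k, v k) * ε) := neg_le_neg (mul_le_mul_of_nonneg_right hle hε0)
    _ = (∑ k, v k) * -ε := by ring
    _ ≤ _ := mul_le_mul_of_nonneg_left hval hsum0

/-- The regret of a run in terms of its parameter errors. -/
theorem D_mixture_sub_le [MeasurableSpace.CountablyGenerated Y] (hm : 1 ≤ m) (hT : 1 ≤ T)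
    (hq : 1 ≤ q) (h : 𝓜.IsRun D q T w θ π) {ε : ℝ} (hε0 : 0 ≤ ε)
    (hε : ∀ t ∈ Finset.Icc 1 T, ∀ i, ‖θ t i - 𝓜.θstar i‖ ≤ ε) (πstar : 𝓜.Policy) :
    𝓜.D q (𝓜.mixture T π) - 𝓜.D q πstar.toKernel ≤ 2 * (√(m : ℝ) * ε) +
      10 * (𝓜.B * √(m : ℝ) * (T : ℝ) ^ (-(1 / (2 * (q : ℝ))))) * (1 + Real.log T) := by
  have hζ : ∀ n, 0 ≤ 𝓜.ζ n := fun n => (𝓜.ζ_pos n).le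
  have hW := 𝓜.isUpperTarget_W hm
  have hB : 0 ≤ 𝓜.B := zero_le_one.trans 𝓜.one_le_B
  let V : ℕ → EuclideanSpace ℝ (Fin m) := fun t => 𝓜.value (θ t) (π t).toKernel
  let R : ℕ → EuclideanSpace ℝ (Fin m) := fun t => 𝓜.S (π t).toKernel
  have h1 : malfare q 𝓜.ζ 𝓜.W (𝓜.S (𝓜.mixture T π)) ≤ malfare q 𝓜.ζ 𝓜.W (runAvg R T) :=
    malfare_antitone hq hζ hW fun i => 𝓜.runAvg_value_le hT π 𝓜.θstar_mem_params i
  have h2 := malfare_le_add_norm (W := 𝓜.W) hq hζ 𝓜.ζ_sum (runAvg V T) (runAvg R T)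
  -- The error `√m * ε` enters twice: here, from estimated to true values, and in the potential
  -- argument through the directions.
  have h3 : ‖runAvg R T - runAvg V T‖ ≤ √(m : ℝ) * ε := by
    rw [runAvg_sub]
    refine norm_le_sqrt_mul hε0 fun i => abs_runAvg_apply_le hT fun t ht => ?_
    rw [PiLp.sub_apply, abs_sub_comm]
    exact (𝓜.abs_value_sub_le (h.est_mem t ht) 𝓜.θstar_mem_params (π t) i).trans (hε t ht i)
  have h4 := malfare_runAvg_le (u := 𝓜.S πstar.toKernel) (V := V) (ε := √(m : ℝ) * ε) hq hζ
    𝓜.ζ_sum hW hT hB (by positivity)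
    (fun t ht i => 𝓜.abs_value_le_of_isMaxOn (h.dir_mem t ht) (h.est_mem t ht) (h.greedy t ht) i)
    (fun i => 𝓜.value_le_B 𝓜.θstar_mem_params πstar i)
    (fun t ht htT => 𝓜.inner_malfareDir_ge hm hq h hε0 hε πstar ht htT)
  unfold Model.D
  linarith

theorem sqrt_log_add_le {x d B' : ℝ} (hx : 1 ≤ x) (hd : 1 ≤ d) :
    √d * √(8 * Real.log (2 * x)) + 2 + B' ≤
      √d * (1 + Real.log x) * (5 + Real.exp B') := by
  have hℓ := Real.log_nonneg hx
  have h1 : √(8 * Real.log (2 * x)) ≤ 3 * (1 + Real.log x) := by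
    rw [Real.sqrt_le_left (by positivity), Real.log_mul (by norm_num) (by positivity)]
    have := Real.log_two_lt_d9
    nlinarith
  have h2 : 1 ≤ √d := Real.one_le_sqrt.2 hd
  have h3 : 1 ≤ √d * (1 + Real.log x) := one_le_mul_of_one_le_of_one_le h2 (by linarith)
  have h4 : B' ≤ Real.exp B' := by linarith [Real.add_one_le_exp B']
  have h5 : √d * √(8 * Real.log (2 * x)) ≤ √d * (3 * (1 + Real.log x)) := by gcongr
  have h6 : 2 + Real.exp B' ≤ √d * (1 + Real.log x) * (2 + Real.exp B') :=
    le_mul_of_one_le_left (by positivity) h3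
  linarith

end run

end Model

end MORLHF

end

theorem theorem3 :
    ∃ (Q : MvPolynomial (Fin 3) ℝ) (K : ℝ) (k : ℕ),
      ∀ (X Y Ω : Type*) [MeasurableSpace X] [MeasurableSpace Y]
        [MeasurableSpace.CountablyGenerated Y] [MeasurableSpace Ω]
        (P : Measure Ω) [IsProbabilityMeasure P]
        (m d N M T q : ℕ), 1 ≤ m → 1 ≤ d → 1 ≤ N → 1 ≤ M → 1 ≤ T → 1 ≤ q →
      ∀ (𝓜 : MORLHF.Model X Y m d N)
        (A : Fin m → Fin M → Ω → X × Y × Y) (b : Fin m → Fin M → Ω → Bool),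
        (∀ i, MORLHF.Model.IsBTData P (𝓜.reward 𝓜.θstar i) (A i) (b i)) →
      ∀ δ : ℝ, 0 < δ → δ < 1 →
        ∃ G : Set Ω, MeasurableSet G ∧ ENNReal.ofReal (1 - δ) ≤ P G ∧
          ∀ ω ∈ G,
            ∀ D : MORLHF.Model.Dataset X Y m M,
              (∀ i j, D i j = MORLHF.Model.ranked (A i j ω) (b i j ω)) →
            ∀ (w : ℕ → Fin m → ℝ) (θ : ℕ → Fin m → EuclideanSpace ℝ (Fin d))
              (π : ℕ → 𝓜.Policy), 𝓜.IsRun D q T w θ π →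
              MORLHF.expKL 𝓜.ρ (𝓜.mixture T π) 𝓜.πref ≠ ∞ ∧
              ∀ πstar : 𝓜.Policy,
                𝓜.D q (𝓜.mixture T π) - 𝓜.D q πstar.toKernel ≤
                  (N : ℝ) * (m : ℝ) ^ (3 / 2 : ℝ) * √(d : ℝ) / √(M : ℝ) *
                      (MvPolynomial.eval
                          ![Real.exp 𝓜.B',
                            ((⨅ i, MORLHF.lambdaMin (𝓜.covMatrix D i)) + 1 / (M : ℝ))⁻¹,
                            (⨅ n, 𝓜.ζ n) ^ (-(1 / (2 * (q : ℝ))))] Q *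
                        (1 + Real.log (m * d / δ)) ^ k) +
                    K * (𝓜.B * √(m : ℝ) * (T : ℝ) ^ (-(1 / (2 * (q : ℝ))))) *
                      (1 + Real.log T) ^ k := by
  -- The 16 is `2 * 8` from `D_mixture_sub_le` and `norm_sub_θstar_le`, the square of `X 0` is the
  -- inverse curvature `exp (2 * B')`, and `5 + X 0` comes from `sqrt_log_add_le`.
  refine ⟨MvPolynomial.C 16 * (MvPolynomial.C 5 + MvPolynomial.X 0) * MvPolynomial.X 0 ^ 2 *
    MvPolynomial.X 1, 10, 1, ?_⟩
  intro X Y Ω _ _ _ _ P _ m d N M T q hm hd hN hM hT hq 𝓜 A b hD δ hδ hδ1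
  obtain ⟨G, hG, hPG, hscore⟩ := 𝓜.exists_score_event hm hd hM hD hδ hδ1
  refine ⟨G, hG, hPG, fun ω hω D hDω w θ π hrun => ⟨𝓜.expKL_mixture_ne_top hT π, fun πstar => ?_⟩⟩
  have hm1 : (1 : ℝ) ≤ m := by exact_mod_cast hm
  have hd1 : (1 : ℝ) ≤ d := by exact_mod_cast hd
  have hN1 : (1 : ℝ) ≤ N := by exact_mod_cast hN
  have hM0 : (0 : ℝ) < M := by exact_mod_cast hM
  have hx : 1 ≤ m * d / δ := by
    rw [le_div_iff₀ hδ]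
    nlinarith
  have hest : ∀ t ∈ Finset.Icc 1 T, ∀ i, ‖θ t i - 𝓜.θstar i‖ ≤ _ := fun t ht i =>
    𝓜.norm_sub_θstar_le hM (by positivity) (hscore ω hω D hDω) (hrun.dir_mem t ht)
      (hrun.est_mem t ht) (𝓜.sum_L_le_of_isMaxOn (hrun.dir_mem t ht) (hrun.est_mem t ht)
        𝓜.θstar_mem_params (hrun.est_max t ht)) i
  have hε0 := (norm_nonneg _).trans (hest 1 (Finset.mem_Icc.2 ⟨le_rfl, hT⟩) ⟨0, hm⟩)
  have hmain := 𝓜.D_mixture_sub_le hm hT hq hrun hε0 hest πstar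
  refine hmain.trans ?_
  simp only [map_mul, map_add, map_pow, MvPolynomial.eval_C, MvPolynomial.eval_X, pow_one,
    Matrix.cons_val_zero, Matrix.cons_val_one]
  have hlam : 0 < (⨅ i, MORLHF.lambdaMin (𝓜.covMatrix D i)) + 1 / (M : ℝ) :=
    add_pos_of_nonneg_of_pos
      (Real.iInf_nonneg fun i => MORLHF.lambdaMin_nonneg (𝓜.posSemidef_covMatrix D i))
      (by positivity)
  set lam := (⨅ i, MORLHF.lambdaMin (𝓜.covMatrix D i)) + 1 / (M : ℝ)
  have hs := MORLHF.Model.sqrt_log_add_le (B' := 𝓜.B') hx hd1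
  have hℓ := Real.log_nonneg hx
  -- The argument yields the factor `√m * √m = m`, which is weakened to the stated one.
  have hNm : (m : ℝ) ≤ N * (m : ℝ) ^ (3 / 2 : ℝ) := by
    have h1 : (m : ℝ) ^ (1 : ℝ) ≤ (m : ℝ) ^ (3 / 2 : ℝ) :=
      Real.rpow_le_rpow_of_exponent_le hm1 (by norm_num)
    rw [Real.rpow_one] at h1
    nlinarith
  refine add_le_add ?_ le_rfl
  have hB' : 0 ≤ 𝓜.B' := (norm_nonneg _).trans (𝓜.norm_le_B' ⟨0, hm⟩ _ (𝓜.θstar_mem _))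
  calc 2 * (√(m : ℝ) * (8 * (√(d : ℝ) * √(8 * Real.log (2 * (m * d / δ))) + 2 + 𝓜.B') *
        √(m : ℝ) * Real.exp 𝓜.B' ^ 2 * lam⁻¹ / √(M : ℝ)))
      = (√(m : ℝ) * √(m : ℝ)) * (16 * (√(d : ℝ) * √(8 * Real.log (2 * (m * d / δ))) + 2 + 𝓜.B') *
        Real.exp 𝓜.B' ^ 2 * lam⁻¹ / √(M : ℝ)) := by ring
    _ ≤ (N * (m : ℝ) ^ (3 / 2 : ℝ)) * (16 * (√(d : ℝ) * (1 + Real.log (m * d / δ)) *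
        (5 + Real.exp 𝓜.B')) * Real.exp 𝓜.B' ^ 2 * lam⁻¹ / √(M : ℝ)) := by
      rw [Real.mul_self_sqrt (by positivity)]
      exact mul_le_mul hNm (by gcongr) (by positivity) (by positivity)
    _ = _ := by ring
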